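/- Let $\sigma>0$ and $L,m_1\in(0,\infty]$. Let $\mathcal F=\mathcal F(L,m_1)$ be the set of all $f$ in the second-order Sobolev space $\mathcal W^2([0,1])$ (continuous representatives) with $\|f''\|_{L_2([0,1])}\le L$ and $|f|\le m_1$ on $[0,1]$; for $L=m_1=\infty$ this is all of $\mathcal W^2([0,1])$. Let $n\ge 1$ and $0\le q\le n$ be integers, let $x_1,\dots,x_n\in[0,1]$ be fixed design points, and let $m_2\in[0,\infty]$. Nature draws i.i.d. noise variables $\varepsilon_1,\dots,\varepsilon_n$ from a law $P$ on $\mathbb R$ that has a density, mean $0$ and variance $\sigma^2$. The adversary chooses a set $\mathcal A\subseteq\{1,\dots,n\}$ with $|\mathcal A|\le q$ and values $\widetilde y_i$ with $|\widetilde y_i|\le m_2$ for $i\in\mathcal A$ (arbitrary values if $m_2=\infty$), and $\widetilde y_i=f(x_i)+\varepsilon_i$ for $i\notin\mathcal A$. An estimator is a map $\hat f$ that sends $\widetilde y\in\mathbb R^n$ to a function $\hat f_{\widetilde y}$ on $[0,1]$, such that $(\widetilde y,t)\mapsto\hat f_{\widetilde y}(t)$ is measurable; it may depend on $n,q,\sigma,L,m_1,m_2$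 and the design. Put $$R_2(f,\hat f)=\mathbb E_{\varepsilon}\Big[\sup_{\mathcal S}\|f-\hat f_{\widetilde y}\|_{L_2([0,1])}^2\Big],\qquad R_\infty(f,\hat f)=\mathbb E_{\varepsilon}\Big[\sup_{\mathcal S}\sup_{t\in[0,1]}|f(t)-\hat f_{\widetilde y}(t)|^2\Big],$$ where $\sup_{\mathcal S}$ is taken, for each realization of the noise, over all choices of the adversary. Then there is a constant $c>0$ that depends only on $\sigma,L,m_1$ such that, for all $n,q,x_1,\dots,x_n,m_2$ as above, $$\inf_{\hat f}\ \sup_{f\in\mathcal F,\ P} R_2(f,\hat f)\ \ge\ c\Big(\big(\tfrac qn\big)^3+n^{-4/5}\Big),\qquad \inf_{\hat f}\ \sup_{f\in\mathcal F,\ P} R_\infty(f,\hat f)\ \ge\ c\Big(\big(\tfrac qn\big)^2+\big(\tfrac{\log n}{n}\big)^{3/4}\Big).$$ -/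

import Mathlib

open MeasureTheory ProbabilityTheory Set
open scoped ENNReal ContDiff

noncomputable section

namespace RobustRegression

/-- `v` is a weak derivative of `u` on the open interval `(0,1)`. -/
def IsWeakDeriv (u v : ℝ → ℝ) : Prop :=
  ∀ φ : ℝ → ℝ, ContDiff ℝ ∞ φ → HasCompactSupport φ → tsupport φ ⊆ Ioo (0 : ℝ) 1 →
    ∫ t in Icc (0 : ℝ) 1, u t * deriv φ t = - ∫ t in Icc (0 : ℝ) 1, v t * φ t

/-- `f` lies in the second-order Sobolev space of `[0,1]`, with first and second weak derivatives
`f₁` and `f₂`. As `f` is evaluated at points, it is the continuous representative of its class.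
The values of `f` outside `[0,1]` play no role. -/
structure HasSobolevDerivs (f f₁ f₂ : ℝ → ℝ) : Prop where
  continuousOn : ContinuousOn f (Icc 0 1)
  memLp_zero : MemLp f 2 (volume.restrict (Icc (0 : ℝ) 1))
  memLp_one : MemLp f₁ 2 (volume.restrict (Icc (0 : ℝ) 1))
  memLp_two : MemLp f₂ 2 (volume.restrict (Icc (0 : ℝ) 1))
  weakDeriv_one : IsWeakDeriv f f₁
  weakDeriv_two : IsWeakDeriv f₁ f₂

/-- The second-order Sobolev space `W²([0,1])`. -/
def sobolevSpace : Set (ℝ → ℝ) :=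
  {f | ∃ f₁ f₂ : ℝ → ℝ, HasSobolevDerivs f f₁ f₂}

/-- The functions `f` in `W²([0,1])` with `‖f''‖_{L²} ≤ L` and `|f| ≤ m₁` on `[0,1]`. Either bound
may be `∞`, that is, absent. -/
def sobolevClass (L m₁ : ℝ≥0∞) : Set (ℝ → ℝ) :=
  {f | (∃ f₁ f₂ : ℝ → ℝ, HasSobolevDerivs f f₁ f₂ ∧
        eLpNorm f₂ 2 (volume.restrict (Icc (0 : ℝ) 1)) ≤ L) ∧
      ∀ t ∈ Icc (0 : ℝ) 1, ‖f t‖ₑ ≤ m₁}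

/-- Without bounds, the class is the whole Sobolev space. -/
theorem sobolevClass_top_top : sobolevClass ⊤ ⊤ = sobolevSpace := by
  ext f
  simp [sobolevClass, sobolevSpace]

/-- `ν` is the law of one noise variable: it has a probability density, mean zero and
variance `σ²`. -/
structure IsNoiseLaw (σ : ℝ) (ν : Measure ℝ) : Prop where
  isProbabilityMeasure : IsProbabilityMeasure ν
  absolutelyContinuous : ν ≪ volume
  memLp : MemLp id 2 ν
  mean : ∫ e, e ∂ν = 0
  variance : Var[id; ν] = σ ^ 2

/-- The response vectors that the adversary can produce from the clean responses: it chooses a set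
`A` of at most `q` indices and replaces the responses in `A` by values of its choice, of absolute
value at most `m₂` (with `m₂ = ∞` for arbitrary values). -/
def corruptions {n : ℕ} (q : ℕ) (m₂ : ℝ≥0∞) (clean : Fin n → ℝ) : Set (Fin n → ℝ) :=
  {y | ∃ A : Finset (Fin n), A.card ≤ q ∧ (∀ i ∉ A, y i = clean i) ∧ ∀ i ∈ A, ‖y i‖ₑ ≤ m₂}

/-- The squared `L²` distance on `[0,1]`. -/
def lossTwo (f g : ℝ → ℝ) : ℝ≥0∞ := ∫⁻ t in Icc (0 : ℝ) 1, ‖f t - g t‖ₑ ^ 2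

/-- The squared supremum distance on `[0,1]`. -/
def lossSup (f g : ℝ → ℝ) : ℝ≥0∞ := (⨆ t ∈ Icc (0 : ℝ) 1, ‖f t - g t‖ₑ) ^ 2

/-- The risk `E_ε [sup_S loss (f, fhat)]`: the entries of the noise vector are i.i.d. with law `ν`,
and the supremum over the adversary's choices is taken inside the expectation. Should the supremum
fail to be measurable in the noise, `∫⁻` is the lower integral, the smallest possible reading. -/
def risk (loss : (ℝ → ℝ) → (ℝ → ℝ) → ℝ≥0∞) {n : ℕ} (x : Fin n → ℝ) (q : ℕ) (m₂ : ℝ≥0∞)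
    (ν : Measure ℝ) (f : ℝ → ℝ) (fhat : (Fin n → ℝ) → ℝ → ℝ) : ℝ≥0∞ :=
  ∫⁻ ε, ⨆ y ∈ corruptions q m₂ (fun i => f (x i) + ε i), loss f (fhat y)
    ∂(Measure.pi fun _ : Fin n => ν)

/-- The minimax risk over the function class `F`: the infimum runs over all estimators (jointly
measurable in the observed responses and in the argument; they may depend on everything that is
fixed here), the suprema over the functions in `F` and over the noise laws of variance `σ²`. -/
def minimaxRisk (loss : (ℝ → ℝ) → (ℝ → ℝ) → ℝ≥0∞) (F : Set (ℝ → ℝ)) (σ : ℝ) {n : ℕ}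
    (x : Fin n → ℝ) (q : ℕ) (m₂ : ℝ≥0∞) : ℝ≥0∞ :=
  ⨅ (fhat : (Fin n → ℝ) → ℝ → ℝ) (_ : Measurable (Function.uncurry fhat)),
    ⨆ (f ∈ F) (ν : Measure ℝ) (_ : IsNoiseLaw σ ν), risk loss x q m₂ ν f fhat

end RobustRegression

end

/-!
Every term of the two rates is a separate lower bound, and two lower bounds give half of their sum.
As `lossTwo ≤ lossSup`, bounds for the integrated loss serve for the supremum loss as well.

*Contamination.* The noise law may depend on the sample size, and it may have heavy tails. Take the
constant regression function `η M`, with `η` proportional to `q / n`, and let the response be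
uniform on `[-a, a]` with probability `1 - η`, and such a variable displaced by `M` otherwise; the
noise is then centred, and `M` of order `η ^ (-1/2)` makes its variance `σ²`. The adversary
replaces every displaced response by zero; with probability at least `1/2` there are at most `q` of
them (Markov). What remains does not depend on the sign of `M`, so that `η M` and `-η M` cannot be
told apart, although they are of order `√(q / n)`. This gives the rate `q / n`
(`exists_le_minimaxRisk_contamination`), which dominates both `(q / n) ^ 3` and `(q / n) ^ 2`. The
corrupted value is always zero, so the bound `m₂` plays no role.

*Noise, integrated loss.* The adversary is idle and the noise is Gaussian. Split `[0,1]` into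
`m ≈ n ^ (1/5)` bins, and put into each of them either nothing or a bump of height `a ≈ m ^ (-2)`.
Whatever the design is, at least half of the bins hold at most `2n/m` design points
(`le_two_mul_card_goodBins`), and in such a bin the data do not reveal whether the bump is
there: the likelihood ratio has second moment at most `2`, whence the two laws overlap in mass at
least `1/2` (`half_le_lintegral_min_one`). Summing over the bins (Assouad's argument,
`le_minimaxRisk_lossTwo_of_bumps`) gives `a² ≈ n ^ (-4/5)`.

*Noise, supremum loss.* A single bump may be higher, `a² ≈ m ^ (-3)`, because the constraint on the
second derivative is an integral. The zero function is tested against the uniform mixture of the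
single bumps in the good bins. Different bumps see different design points, so the likelihood ratio
of the mixture has second moment at most `2` as long as that of each single bump is at most the
number of bins (`lintegral_mixtureRatio_sq_le`); this permits `m ≈ (n / log n) ^ (1/4)`. The
supremum over `[0,1]` need not be measurable in the data; it is bounded below by the losses at the
centres of the bins, which are (`le_minimaxRisk_lossSup_of_bumps`).
-/

namespace RobustRegression

/-! ### Gaussian likelihood ratios -/

section

theorem lintegral_pi_prod {n : ℕ} (μ : Measure ℝ) [IsProbabilityMeasure μ] (g : Fin n → ℝ → ℝ≥0∞)
    (hg : ∀ i, Measurable (g i)) :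
    ∫⁻ ε, ∏ i, g i (ε i) ∂(Measure.pi fun _ : Fin n => μ) = ∏ i, ∫⁻ e, g i e ∂μ := by
  refine (lintegral_prod_eq_prod_lintegral_of_indepFun Finset.univ
    (fun i (ε : Fin n → ℝ) => g i (ε i)) (iIndepFun_pi fun i => (hg i).aemeasurable)
    fun i => (hg i).comp (measurable_pi_apply i)).trans ?_
  refine Finset.prod_congr rfl fun i _ => ?_
  exact (measurePreserving_eval (fun _ : Fin n => μ) i).lintegral_comp (hg i)

/-- The law of `n` independent centred Gaussian variables of variance `v`. -/
noncomputable def gaussianNoise (v : NNReal) (n : ℕ) : Measure (Fin n → ℝ) :=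
  Measure.pi fun _ => gaussianReal 0 v

instance (v : NNReal) (n : ℕ) : IsProbabilityMeasure (gaussianNoise v n) := by
  unfold gaussianNoise; infer_instance

/-- The likelihood ratio, at `ε`, of Gaussian noise shifted by `w` against unshifted noise. -/
noncomputable def likelihoodRatio {n : ℕ} (v : NNReal) (w ε : Fin n → ℝ) : ℝ≥0∞ :=
  ENNReal.ofReal (Real.exp (∑ i, (w i * ε i - w i ^ 2 / 2) / v))

theorem measurable_likelihoodRatio {n : ℕ} (v : NNReal) (w : Fin n → ℝ) :
    Measurable (likelihoodRatio v w) := by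
  unfold likelihoodRatio; fun_prop

theorem gaussianReal_eq_withDensity {v : NNReal} (hv : v ≠ 0) (w : ℝ) :
    gaussianReal w v = (gaussianReal 0 v).withDensity
      fun e => ENNReal.ofReal (Real.exp ((w * e - w ^ 2 / 2) / v)) := by
  rw [gaussianReal_of_var_ne_zero _ hv, gaussianReal_of_var_ne_zero _ hv,
    ← withDensity_mul _ (measurable_gaussianPDF _ _) (by fun_prop)]
  congr 1
  ext e
  simp only [Pi.mul_apply, gaussianPDF, gaussianPDFReal]
  rw [← ENNReal.ofReal_mul (by positivity), mul_assoc _ (Real.exp _), ← Real.exp_add]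
  have : (v : ℝ) ≠ 0 := by exact_mod_cast hv
  congr 3
  field_simp
  ring

/-- Shifting Gaussian noise by `w` multiplies its law by the likelihood ratio. -/
theorem map_add_gaussianNoise {n : ℕ} {v : NNReal} (hv : v ≠ 0) (w : Fin n → ℝ) :
    (gaussianNoise v n).map (fun ε => w + ε)
      = (gaussianNoise v n).withDensity (likelihoodRatio v w) := by
  have h1 : (gaussianNoise v n).map (fun ε => w + ε)
      = Measure.pi fun i => gaussianReal (w i) v := by
    have := Measure.pi_map_pi (μ := fun _ : Fin n => gaussianReal 0 v)
      (f := fun i e => w i + e) fun i => by fun_prop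
    simp only [gaussianReal_map_const_add, zero_add] at this
    exact this
  rw [h1]
  refine Measure.pi_eq fun s hs => ?_
  rw [withDensity_apply _ (.univ_pi hs), ← lintegral_indicator (.univ_pi hs)]
  have : (Set.univ.pi s).indicator (likelihoodRatio v w) = fun ε => ∏ i, (s i).indicator
      (fun e => ENNReal.ofReal (Real.exp ((w i * e - w i ^ 2 / 2) / v))) (ε i) := by
    ext ε
    by_cases h : ε ∈ Set.univ.pi s
    · rw [Set.indicator_of_mem h, likelihoodRatio, Real.exp_sum,
        ENNReal.ofReal_prod_of_nonneg fun i _ => (Real.exp_pos _).le]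
      refine Finset.prod_congr rfl fun i _ => ?_
      rw [Set.indicator_of_mem (h i trivial)]
    · rw [Set.indicator_of_notMem h]
      simp only [Set.mem_pi, Set.mem_univ, true_imp_iff, not_forall] at h
      obtain ⟨i, hi⟩ := h
      exact (Finset.prod_eq_zero (Finset.mem_univ i) (Set.indicator_of_notMem hi _)).symm
  rw [this, gaussianNoise, lintegral_pi_prod _ _ fun i => Measurable.indicator (by fun_prop) (hs i)]
  refine Finset.prod_congr rfl fun i _ => ?_
  rw [gaussianReal_eq_withDensity hv (w i), withDensity_apply _ (hs i), lintegral_indicator (hs i)]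

theorem lintegral_add_gaussianNoise {n : ℕ} {v : NNReal} (hv : v ≠ 0) (w : Fin n → ℝ)
    {g : (Fin n → ℝ) → ℝ≥0∞} (hg : Measurable g) :
    ∫⁻ ε, g (w + ε) ∂gaussianNoise v n
      = ∫⁻ ε, likelihoodRatio v w ε * g ε ∂gaussianNoise v n := by
  rw [← lintegral_map hg (measurable_const_add w), map_add_gaussianNoise hv,
    lintegral_withDensity_eq_lintegral_mul _ (measurable_likelihoodRatio v w) hg]
  rfl

theorem lintegral_likelihoodRatio {n : ℕ} {v : NNReal} (hv : v ≠ 0) (w : Fin n → ℝ) :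
    ∫⁻ ε, likelihoodRatio v w ε ∂gaussianNoise v n = 1 := by
  simpa using (lintegral_add_gaussianNoise hv w (g := fun _ => 1) measurable_const).symm

/-- The second moments of the likelihood ratios; orthogonal shifts have uncorrelated ratios. -/
theorem lintegral_likelihoodRatio_mul {n : ℕ} {v : NNReal} (hv : v ≠ 0) (w w' : Fin n → ℝ) :
    ∫⁻ ε, likelihoodRatio v w ε * likelihoodRatio v w' ε ∂gaussianNoise v n
      = ENNReal.ofReal (Real.exp (∑ i, w i * w' i / v)) := by
  have : ∀ ε, likelihoodRatio v w ε * likelihoodRatio v w' ε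
      = ENNReal.ofReal (Real.exp (∑ i, w i * w' i / v)) * likelihoodRatio v (w + w') ε := by
    intro ε
    unfold likelihoodRatio
    rw [← ENNReal.ofReal_mul (Real.exp_pos _).le, ← ENNReal.ofReal_mul (Real.exp_pos _).le,
      ← Real.exp_add, ← Real.exp_add, ← Finset.sum_add_distrib, ← Finset.sum_add_distrib]
    congr 2
    refine Finset.sum_congr rfl fun i _ => ?_
    simp only [Pi.add_apply]
    ring
  simp_rw [this]
  rw [lintegral_const_mul _ (measurable_likelihoodRatio v _), lintegral_likelihoodRatio hv, mul_one]

/-- A density whose second moment is at most `2` overlaps with the constant density `1` in mass at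
least `1/2`, because `min 1 x ≥ x - x²/4`. -/
theorem half_le_lintegral_min_one {Ω : Type*} [MeasurableSpace Ω] (P : Measure Ω)
    {l : Ω → ℝ≥0∞} (hl : Measurable l) (h1 : ∫⁻ z, l z ∂P = 1)
    (h2 : ∫⁻ z, l z * l z ∂P ≤ 2) : 1 / 2 ≤ ∫⁻ z, min 1 (l z) ∂P := by
  have key : ∀ z, l z ≤ min 1 (l z) + 1 / 4 * (l z * l z) := by
    intro z
    rcases le_total (l z) 1 with h | h
    · rw [min_eq_right h]; exact le_self_add
    · rw [min_eq_left h]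
      rcases eq_or_ne (l z) ⊤ with ht | ht
      · rw [ht]; simp [ENNReal.mul_top]
      · lift l z to NNReal using ht with x
        have : ((1 : ℝ≥0∞) / 4) = (((1 / 4 : NNReal)) : ℝ≥0∞) := by
          rw [ENNReal.coe_div (by norm_num)]; norm_num
        rw [this]
        norm_cast
        rw [← NNReal.coe_le_coe]
        push_cast
        nlinarith [sq_nonneg ((x : ℝ) - 2)]
  have h3 : (1 : ℝ≥0∞) ≤ ∫⁻ z, min 1 (l z) ∂P + 1 / 2 := by
    calc (1 : ℝ≥0∞) = ∫⁻ z, l z ∂P := h1.symm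
      _ ≤ ∫⁻ z, (min 1 (l z) + 1 / 4 * (l z * l z)) ∂P := lintegral_mono key
      _ = ∫⁻ z, min 1 (l z) ∂P + 1 / 4 * ∫⁻ z, l z * l z ∂P := by
        rw [lintegral_add_left (measurable_const.min hl)]
        congr 1
        exact lintegral_const_mul _ (hl.mul hl)
      _ ≤ ∫⁻ z, min 1 (l z) ∂P + 1 / 4 * 2 := by gcongr
      _ = _ := by
        congr 1
        rw [show (4 : ℝ≥0∞) = 2 * 2 by norm_num, one_div, one_div,
          ENNReal.mul_inv (by simp) (by simp), mul_assoc, ENNReal.inv_mul_cancel (by simp) (by simp),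
          mul_one]
  have h4 : (1 : ℝ≥0∞) - 1 / 2 ≤ ∫⁻ z, min 1 (l z) ∂P := tsub_le_iff_right.2 h3
  simpa [ENNReal.one_sub_inv_two] using h4

end

/-! ### Bumps in the Sobolev class -/

section

/-- Integration by parts; the boundary terms vanish because the test function is supported in the
open interval. -/
theorem isWeakDeriv_of_hasDerivAt {u v : ℝ → ℝ} (h : ∀ t, HasDerivAt u (v t) t)
    (hv : Continuous v) : IsWeakDeriv u v := by
  intro φ hφ _ hsupp
  have h0 : φ 0 = 0 := image_eq_zero_of_notMem_tsupport fun h => (hsupp h).1.false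
  have h1 : φ 1 = 0 := image_eq_zero_of_notMem_tsupport fun h => (hsupp h).2.false
  have hd : ∀ t, HasDerivAt φ (deriv φ t) t := fun t =>
    (hφ.differentiable (by simp)).differentiableAt.hasDerivAt
  have hc : Continuous (deriv φ) := hφ.continuous_deriv (by simp)
  have := intervalIntegral.integral_mul_deriv_eq_deriv_mul (a := 0) (b := 1)
    (fun t _ => h t) (fun t _ => hd t) (hv.intervalIntegrable _ _) (hc.intervalIntegrable _ _)
  rw [integral_Icc_eq_integral_Ioc, integral_Icc_eq_integral_Ioc,
    ← intervalIntegral.integral_of_le zero_le_one, ← intervalIntegral.integral_of_le zero_le_one,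
    this, h0, h1]
  simp

theorem memLp_two_of_continuous {u : ℝ → ℝ} (hu : Continuous u) :
    MemLp u 2 (volume.restrict (Icc (0 : ℝ) 1)) := by
  obtain ⟨C, hC⟩ := isCompact_Icc.exists_bound_of_continuousOn (s := Icc (0 : ℝ) 1) hu.continuousOn
  exact .of_bound hu.aestronglyMeasurable C (ae_restrict_of_forall_mem measurableSet_Icc hC)

theorem mem_sobolevClass_of_hasDerivAt {f f₁ f₂ : ℝ → ℝ} {L m₁ : ℝ≥0∞}
    (h₁ : ∀ t, HasDerivAt f (f₁ t) t) (h₂ : ∀ t, HasDerivAt f₁ (f₂ t) t) (hc : Continuous f₂)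
    (hL : ∫⁻ t in Icc (0 : ℝ) 1, ‖f₂ t‖ₑ ^ 2 ≤ L ^ 2)
    (hm : ∀ t ∈ Icc (0 : ℝ) 1, ‖f t‖ₑ ≤ m₁) : f ∈ sobolevClass L m₁ := by
  have c₁ : Continuous f₁ := continuous_iff_continuousAt.2 fun t => (h₂ t).continuousAt
  have c₀ : Continuous f := continuous_iff_continuousAt.2 fun t => (h₁ t).continuousAt
  refine ⟨⟨f₁, f₂, ⟨c₀.continuousOn, memLp_two_of_continuous c₀, memLp_two_of_continuous c₁,
    memLp_two_of_continuous hc, isWeakDeriv_of_hasDerivAt h₁ c₁,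
    isWeakDeriv_of_hasDerivAt h₂ hc⟩, ?_⟩, hm⟩
  rw [eLpNorm_eq_lintegral_rpow_enorm_toReal (by simp) (by simp)]
  calc (∫⁻ t in Icc (0 : ℝ) 1, ‖f₂ t‖ₑ ^ (2 : ℝ≥0∞).toReal) ^ (1 / (2 : ℝ≥0∞).toReal)
      = (∫⁻ t in Icc (0 : ℝ) 1, ‖f₂ t‖ₑ ^ 2) ^ (1 / (2 : ℝ)) := by simp
    _ ≤ (L ^ 2) ^ (1 / (2 : ℝ)) := by gcongr
    _ = L := by
      rw [← ENNReal.rpow_natCast, ← ENNReal.rpow_mul]; simp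

theorem const_mem_sobolevClass {d μ : ℝ} {L m₁ : ℝ≥0∞} (hd : |d| ≤ μ)
    (hμ : ENNReal.ofReal μ ≤ m₁) : (fun _ => d) ∈ sobolevClass L m₁ := by
  refine mem_sobolevClass_of_hasDerivAt (f₁ := fun _ => 0) (f₂ := fun _ => 0)
    (fun t => hasDerivAt_const _ _) (fun t => hasDerivAt_const _ _) continuous_const (by simp)
    fun t _ => ?_
  rw [Real.enorm_eq_ofReal_abs]
  exact (ENNReal.ofReal_le_ofReal hd).trans hμ

/-- A smooth bump: equal to `1` on `[-1/4, 1/4]`, zero outside `[-1/3, 1/3]`. -/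
noncomputable def bump : ContDiffBump (0 : ℝ) := ⟨1 / 4, 1 / 3, by norm_num, by norm_num⟩

theorem bump_eq_one {s : ℝ} (hs : |s| ≤ 1 / 4) : bump s = 1 :=
  bump.one_of_mem_closedBall (by simpa [bump] using hs)

theorem tsupport_deriv_subset_closedBall {g : ℝ → ℝ}
    (hg : tsupport g ⊆ Metric.closedBall 0 (1 / 3)) :
    tsupport (deriv g) ⊆ Metric.closedBall 0 (1 / 3) :=
  (closure_minimal support_deriv_subset (isClosed_tsupport g)).trans hg

theorem tsupport_bump : tsupport bump ⊆ Metric.closedBall 0 (1 / 3) := by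
  rw [bump.tsupport_eq]; rfl

theorem eq_zero_of_tsupport_subset {g : ℝ → ℝ} (hg : tsupport g ⊆ Metric.closedBall 0 (1 / 3))
    (s : ℝ) (hs : 1 / 2 ≤ |s|) : g s = 0 := by
  refine image_eq_zero_of_notMem_tsupport fun h => ?_
  have := hg h
  simp only [Metric.mem_closedBall, dist_zero_right, Real.norm_eq_abs] at this
  linarith

theorem exists_bound_deriv_deriv_bump : ∃ K : ℝ, 0 < K ∧ ∀ s, |deriv (deriv bump) s| ≤ K := by
  have hc : Continuous (deriv (deriv bump)) := by
    have h : ContDiff ℝ 2 bump := bump.contDiff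
    have h' : ContDiff ℝ 1 (deriv bump) := h.deriv'
    exact h'.continuous_deriv (by simp)
  have hs : HasCompactSupport (deriv (deriv bump)) := bump.hasCompactSupport.deriv.deriv
  obtain ⟨K, hK⟩ := hs.exists_bound_of_continuous hc
  exact ⟨max K 1, by positivity, fun s => (hK s).trans (le_max_left _ _)⟩

/-- The `j`-th of `m` copies of the profile `g`, shrunk and moved to the `j`-th of the intervals
`(j/m, (j+1)/m)`, weighted by `θ j` and added up. -/
noncomputable def bumpSum {m : ℕ} (g : ℝ → ℝ) (θ : Fin m → ℝ) (t : ℝ) : ℝ :=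
  ∑ j, θ j * g (m * t - j - 1 / 2)

/-- The `j`-th of `m` intervals of equal length in `[0,1]`. -/
def bin {m : ℕ} (j : Fin m) : Set ℝ := {t | |m * t - j - 1 / 2| < 1 / 2}

theorem bin_eq_Ioo {m : ℕ} (j : Fin m) : bin j = Ioo ((j : ℝ) / m) ((j + 1) / m) := by
  have : (0 : ℝ) < m := by exact_mod_cast j.pos
  ext t
  simp only [bin, mem_ofPred_eq, abs_lt, mem_Ioo, div_lt_iff₀ this, lt_div_iff₀ this]
  constructor <;> rintro ⟨h, h'⟩ <;> constructor <;> linarith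

theorem volume_bin {m : ℕ} (j : Fin m) : volume (bin j) = ENNReal.ofReal (1 / m) := by
  rw [bin_eq_Ioo, Real.volume_Ioo]; congr 1; ring

theorem bin_disjoint {m : ℕ} {j k : Fin m} {t : ℝ} (hj : t ∈ bin j) (hk : t ∈ bin k) : j = k := by
  simp only [bin, mem_ofPred_eq, abs_lt] at hj hk
  have h1 : (j : ℝ) < k + 1 := by linarith
  have h2 : (k : ℝ) < j + 1 := by linarith
  norm_cast at h1 h2
  exact Fin.ext (by omega)

variable {m : ℕ} {g : ℝ → ℝ} {θ : Fin m → ℝ}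

theorem bumpSum_eq_of_mem (hg : ∀ s, 1 / 2 ≤ |s| → g s = 0) {t : ℝ} {j : Fin m} (hj : t ∈ bin j) :
    bumpSum g θ t = θ j * g (m * t - j - 1 / 2) := by
  refine Finset.sum_eq_single j (fun k _ hk => ?_) (by simp)
  rw [hg _ (not_lt.1 fun h => hk (bin_disjoint (j := k) h hj)), mul_zero]

theorem bumpSum_eq_zero (hg : ∀ s, 1 / 2 ≤ |s| → g s = 0) {t : ℝ} (ht : ∀ j : Fin m, t ∉ bin j) :
    bumpSum g θ t = 0 :=
  Finset.sum_eq_zero fun k _ => by rw [hg _ (not_lt.1 fun h => ht k h), mul_zero]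

theorem hasDerivAt_bumpSum (θ : Fin m → ℝ) {g' : ℝ → ℝ} (h : ∀ s, HasDerivAt g (g' s) s) (t : ℝ) :
    HasDerivAt (bumpSum g θ) (m * bumpSum g' θ t) t := by
  have : ∀ j ∈ (Finset.univ : Finset (Fin m)),
      HasDerivAt (fun t : ℝ => θ j * g (m * t - j - 1 / 2))
      (θ j * (g' (m * t - j - 1 / 2) * m)) t := by
    intro j _
    have h1 : HasDerivAt (fun t : ℝ => m * t - j - 1 / 2) (m : ℝ) t := by
      simpa using (((hasDerivAt_id t).const_mul (m : ℝ)).sub_const (j : ℝ)).sub_const (1 / 2)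
    exact ((h _).comp t h1).const_mul _
  have hs : m * bumpSum g' θ t = ∑ j, θ j * (g' (m * t - j - 1 / 2) * m) := by
    rw [bumpSum, Finset.mul_sum]
    exact Finset.sum_congr rfl fun j _ => by ring
  rw [hs]
  exact HasDerivAt.fun_sum this

theorem continuous_bumpSum (θ : Fin m → ℝ) (h : Continuous g) : Continuous (bumpSum g θ) := by
  unfold bumpSum; fun_prop

/-- At most one term of the sum is nonzero at each point, and each of them lives on a set of measure
`1 / m`. -/
theorem lintegral_bumpSum_le (hg : ∀ s, 1 / 2 ≤ |s| → g s = 0) {K : ℝ} (hK : ∀ s, |g s| ≤ K)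
    (c : ℝ) : ∫⁻ t in Icc (0 : ℝ) 1, ‖c * bumpSum g θ t‖ₑ ^ 2
      ≤ ENNReal.ofReal (c ^ 2 * K ^ 2 * (∑ j, θ j ^ 2) / m) := by
  have key : ∀ t, ‖c * bumpSum g θ t‖ₑ ^ 2
      ≤ ∑ j, (bin j).indicator (fun _ => ENNReal.ofReal (c ^ 2 * K ^ 2 * θ j ^ 2)) t := by
    intro t
    by_cases ht : ∃ j : Fin m, t ∈ bin j
    · obtain ⟨j, hj⟩ := ht
      refine le_trans ?_ (Finset.single_le_sum (fun _ _ => zero_le) (Finset.mem_univ j))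
      rw [Set.indicator_of_mem hj, bumpSum_eq_of_mem hg hj, Real.enorm_eq_ofReal_abs,
        ← ENNReal.ofReal_pow (abs_nonneg _), sq_abs]
      refine ENNReal.ofReal_le_ofReal ?_
      have := sq_le_sq' (neg_le_of_abs_le (hK (m * t - j - 1 / 2)))
        (le_of_abs_le (hK (m * t - j - 1 / 2)))
      calc _ = c ^ 2 * θ j ^ 2 * g (m * t - j - 1 / 2) ^ 2 := by ring
        _ ≤ c ^ 2 * θ j ^ 2 * K ^ 2 := by gcongr
        _ = _ := by ring
    · rw [bumpSum_eq_zero hg (not_exists.1 ht)]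
      simp
  calc ∫⁻ t in Icc (0 : ℝ) 1, ‖c * bumpSum g θ t‖ₑ ^ 2 ≤ ∫⁻ t, ‖c * bumpSum g θ t‖ₑ ^ 2 :=
        setLIntegral_le_lintegral _ _
    _ ≤ ∫⁻ t, ∑ j, (bin j).indicator (fun _ => ENNReal.ofReal (c ^ 2 * K ^ 2 * θ j ^ 2)) t :=
        lintegral_mono key
    _ = ∑ j : Fin m, ENNReal.ofReal (c ^ 2 * K ^ 2 * θ j ^ 2) * ENNReal.ofReal (1 / m) := by
        have hm : ∀ j : Fin m, MeasurableSet (bin j) := fun j => by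
          rw [bin_eq_Ioo]; exact measurableSet_Ioo
        rw [lintegral_finsetSum _ fun j _ => measurable_const.indicator (hm j)]
        refine Finset.sum_congr rfl fun j _ => ?_
        rw [lintegral_indicator_const (hm j), volume_bin]
    _ = _ := by
        simp_rw [← ENNReal.ofReal_mul' (show (0 : ℝ) ≤ 1 / m by positivity)]
        rw [← ENNReal.ofReal_sum_of_nonneg fun j _ => by positivity]
        congr 1
        rw [Finset.mul_sum, Finset.sum_div]
        exact Finset.sum_congr rfl fun j _ => by ring

/-- A sum of bumps of height at most `μ` lies in the class if its second derivative, of which each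
bump contributes at most `m³ K² θ²` to the squared norm, is small enough. -/
theorem bumpSum_mem_sobolevClass {K ℓ μ : ℝ} {L m₁ : ℝ≥0∞}
    (hK : ∀ s, |deriv (deriv bump) s| ≤ K) (hℓ0 : 0 ≤ ℓ) (hℓ : ENNReal.ofReal ℓ ≤ L)
    (hμ : ENNReal.ofReal μ ≤ m₁) (hm : 0 < m) (hθ : ∀ j, |θ j| ≤ μ)
    (hb : m ^ 3 * K ^ 2 * ∑ j, θ j ^ 2 ≤ ℓ ^ 2) : bumpSum bump θ ∈ sobolevClass L m₁ := by
  have hcd : ContDiff ℝ 2 bump := bump.contDiff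
  have hcd1 : ContDiff ℝ 1 (deriv bump) := hcd.deriv'
  have s0 := tsupport_bump
  have s2 := tsupport_deriv_subset_closedBall (tsupport_deriv_subset_closedBall s0)
  have hm0 : (0 : ℝ) < m := by exact_mod_cast hm
  refine mem_sobolevClass_of_hasDerivAt (f₁ := fun t => m * bumpSum (deriv bump) θ t)
    (f₂ := fun t => m * (m * bumpSum (deriv (deriv bump)) θ t))
    (hasDerivAt_bumpSum θ fun s => (hcd.differentiable (by simp)).differentiableAt.hasDerivAt)
    (fun t => (hasDerivAt_bumpSum θ
      (fun s => (hcd1.differentiable (by simp)).differentiableAt.hasDerivAt) t).const_mul _)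
    ?_ ?_ ?_
  · have := continuous_bumpSum θ (hcd1.continuous_deriv (by simp))
    fun_prop
  · simp_rw [← mul_assoc]
    refine (lintegral_bumpSum_le (eq_zero_of_tsupport_subset s2) hK _).trans ?_
    calc _ ≤ ENNReal.ofReal (ℓ ^ 2) := by
          refine ENNReal.ofReal_le_ofReal (le_trans (le_of_eq ?_) hb)
          field_simp
      _ ≤ L ^ 2 := by rw [ENNReal.ofReal_pow hℓ0]; gcongr
  · intro t _
    rw [Real.enorm_eq_ofReal_abs]
    refine le_trans ?_ hμ
    by_cases ht : ∃ j : Fin m, t ∈ bin j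
    · obtain ⟨j, hj⟩ := ht
      rw [bumpSum_eq_of_mem (eq_zero_of_tsupport_subset s0) hj, abs_mul, abs_of_nonneg bump.nonneg]
      exact ENNReal.ofReal_le_ofReal
        ((mul_le_of_le_one_right (abs_nonneg _) bump.le_one).trans (hθ j))
    · rw [bumpSum_eq_zero (eq_zero_of_tsupport_subset s0) (not_exists.1 ht)]
      simp

end

/-! ### Contaminated heavy-tailed responses -/

section

/-- The uniform law on `[-a, a]`. -/
noncomputable def uniformLaw (a : ℝ) : Measure ℝ :=
  ENNReal.ofReal (1 / (2 * a)) • volume.restrict (Icc (-a) a)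

theorem uniformLaw_absolutelyContinuous (a : ℝ) : uniformLaw a ≪ volume :=
  (Measure.smul_absolutelyContinuous).trans Measure.absolutelyContinuous_restrict

theorem isProbabilityMeasure_uniformLaw {a : ℝ} (ha : 0 < a) :
    IsProbabilityMeasure (uniformLaw a) := by
  constructor
  rw [uniformLaw, Measure.smul_apply, Measure.restrict_apply_univ, Real.volume_Icc, smul_eq_mul,
    ← ENNReal.ofReal_mul (by positivity), ← ENNReal.ofReal_one]
  congr 1
  field_simp
  ring

theorem ae_uniformLaw (a : ℝ) : ∀ᵐ u ∂uniformLaw a, |u| ≤ a := by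
  refine Measure.ae_smul_measure ?_ _
  filter_upwards [ae_restrict_mem measurableSet_Icc] with u hu
  exact abs_le.2 hu

theorem integral_uniformLaw {a : ℝ} (ha : 0 < a) (g : ℝ → ℝ) :
    ∫ u, g u ∂uniformLaw a = 1 / (2 * a) * ∫ u in (-a)..a, g u := by
  rw [uniformLaw, integral_smul_measure, ENNReal.toReal_ofReal (by positivity), smul_eq_mul,
    integral_Icc_eq_integral_Ioc, ← intervalIntegral.integral_of_le (by linarith)]

/-- The heavy-tailed noise law: with probability `1 - η` a uniform variable on `[-a, a]`, with
probability `η` such a variable displaced by `M`, and the whole centred. -/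
noncomputable def heavyTailLaw (a η M : ℝ) : Measure ℝ :=
  ENNReal.ofReal (1 - η) • (uniformLaw a).map (fun u => u - η * M)
    + ENNReal.ofReal η • (uniformLaw a).map (fun u => u + (M - η * M))

section HeavyTail

variable {a η M : ℝ}

theorem isProbabilityMeasure_heavyTailLaw (ha : 0 < a) (h0 : 0 ≤ η) (h1 : η ≤ 1) :
    IsProbabilityMeasure (heavyTailLaw a η M) := by
  have := isProbabilityMeasure_uniformLaw ha
  constructor
  rw [heavyTailLaw, Measure.add_apply, Measure.smul_apply, Measure.smul_apply,
    Measure.map_apply (by fun_prop) .univ, Measure.map_apply (by fun_prop) .univ]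
  simp only [preimage_univ, measure_univ, smul_eq_mul, mul_one]
  rw [← ENNReal.ofReal_add (by linarith) h0]
  simp

theorem heavyTailLaw_absolutelyContinuous : heavyTailLaw a η M ≪ volume := by
  have hq : ∀ c : ℝ, (uniformLaw a).map (fun u => u + c) ≪ volume := fun c => by
    have := (uniformLaw_absolutelyContinuous a).map (f := fun u => u + c) (by fun_prop)
    rwa [(measurePreserving_add_right volume c).map_eq] at this
  refine Measure.AbsolutelyContinuous.add_left_iff.2 ⟨?_, ?_⟩
  · simp_rw [sub_eq_add_neg]
    exact Measure.smul_absolutelyContinuous.trans (hq _)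
  · exact Measure.smul_absolutelyContinuous.trans (hq _)

theorem integral_heavyTailLaw (ha : 0 < a) (h0 : 0 ≤ η) (h1 : η ≤ 1) {g : ℝ → ℝ}
    (hg : Continuous g) : ∫ e, g e ∂heavyTailLaw a η M
      = (1 - η) * (1 / (2 * a) * ∫ u in (-a)..a, g (u - η * M))
        + η * (1 / (2 * a) * ∫ u in (-a)..a, g (u + (M - η * M))) := by
  have := isProbabilityMeasure_uniformLaw ha
  have hi : ∀ c, Integrable g ((uniformLaw a).map (fun u => u + c)) := by
    intro c
    rw [integrable_map_measure hg.aestronglyMeasurable (by fun_prop)]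
    refine Integrable.smul_measure ?_ ENNReal.ofReal_ne_top
    exact (Continuous.continuousOn (by fun_prop)).integrableOn_compact isCompact_Icc
  have hi' : Integrable g ((uniformLaw a).map (fun u => u - η * M)) := by
    simpa only [sub_eq_add_neg] using hi (-(η * M))
  rw [heavyTailLaw, integral_add_measure (hi'.smul_measure ENNReal.ofReal_ne_top)
    ((hi _).smul_measure ENNReal.ofReal_ne_top), integral_smul_measure, integral_smul_measure,
    integral_map (by fun_prop) hg.aestronglyMeasurable,
    integral_map (by fun_prop) hg.aestronglyMeasurable, integral_uniformLaw ha,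
    integral_uniformLaw ha, ENNReal.toReal_ofReal h0, ENNReal.toReal_ofReal (by linarith)]
  rfl

theorem memLp_heavyTailLaw (ha : 0 < a) (h0 : 0 ≤ η) (h1 : η ≤ 1) :
    MemLp id 2 (heavyTailLaw a η M) := by
  have := isProbabilityMeasure_heavyTailLaw (M := M) ha h0 h1
  have key : ∀ c : ℝ, ∀ᵐ e ∂(uniformLaw a).map (fun u => u + c), ‖e‖ ≤ a + |c| := by
    intro c
    rw [ae_map_iff (by fun_prop) (measurableSet_le (by fun_prop) (by fun_prop))]
    filter_upwards [ae_uniformLaw a] with u hu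
    exact (norm_add_le _ _).trans (by simpa using hu)
  refine MemLp.of_bound aestronglyMeasurable_id (a + |-(η * M)| + |M - η * M|) ?_
  refine ae_add_measure_iff.2 ⟨Measure.ae_smul_measure ?_ _, Measure.ae_smul_measure ?_ _⟩
  · simp_rw [sub_eq_add_neg]
    filter_upwards [key (-(η * M))] with e he
    exact he.trans (by linarith [abs_nonneg (M + -(η * M))])
  · filter_upwards [key (M - η * M)] with e he
    exact he.trans (by linarith [abs_nonneg (-(η * M))])

theorem isNoiseLaw_heavyTailLaw {σ : ℝ} (ha : 0 < a) (h0 : 0 ≤ η) (h1 : η ≤ 1)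
    (hσ : a ^ 2 / 3 + η * (1 - η) * M ^ 2 = σ ^ 2) : IsNoiseLaw σ (heavyTailLaw a η M) := by
  have hP := isProbabilityMeasure_heavyTailLaw (M := M) ha h0 h1
  have hmean : ∫ e, e ∂heavyTailLaw a η M = 0 := by
    rw [integral_heavyTailLaw ha h0 h1 (g := fun e => e) continuous_id]
    simp
    field_simp
    ring
  refine ⟨hP, heavyTailLaw_absolutelyContinuous, memLp_heavyTailLaw ha h0 h1, hmean, ?_⟩
  have hs : ∀ c : ℝ, ∫ u in (-a)..a, (u + c) ^ 2 = 2 * a * (a ^ 2 / 3 + c ^ 2) := by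
    intro c
    rw [intervalIntegral.integral_comp_add_right (fun u => u ^ 2), integral_pow]
    ring
  have hs' : ∀ c : ℝ, ∫ u in (-a)..a, (u - c) ^ 2 = 2 * a * (a ^ 2 / 3 + c ^ 2) := by
    intro c; simpa [sub_eq_add_neg] using hs (-c)
  rw [variance_eq_sub (memLp_heavyTailLaw ha h0 h1)]
  simp only [Pi.pow_apply, id]
  rw [hmean, integral_heavyTailLaw ha h0 h1 (g := fun e => e ^ 2) (by fun_prop), hs, hs', ← hσ]
  field_simp
  ring

/-- What the adversary makes of a response: values outside `[-a, a]` become zero. -/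
noncomputable def truncate (a y : ℝ) : ℝ := if |y| ≤ a then y else 0

theorem measurable_truncate (a : ℝ) : Measurable (truncate a) :=
  Measurable.ite (measurableSet_le (by fun_prop) measurable_const) measurable_id measurable_const

/-- The law of one response after truncation. -/
noncomputable def truncatedLaw (a η : ℝ) : Measure ℝ :=
  ENNReal.ofReal (1 - η) • uniformLaw a + ENNReal.ofReal η • Measure.dirac 0

/-- Around the regression value `η M`, truncation removes every trace of `M`. -/
theorem map_truncate_heavyTailLaw (ha : 0 < a) (hM : 2 * a < |M|) :
    (heavyTailLaw a η M).map (fun e => truncate a (η * M + e)) = truncatedLaw a η := by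
  have hP := isProbabilityMeasure_uniformLaw ha
  have hT : Measurable fun e => truncate a (η * M + e) :=
    (measurable_truncate a).comp (measurable_const_add _)
  rw [heavyTailLaw, Measure.map_add _ _ hT, Measure.map_smul, Measure.map_smul,
    Measure.map_map hT (by fun_prop), Measure.map_map hT (by fun_prop), truncatedLaw]
  congr 2
  · have : (fun e => truncate a (η * M + e)) ∘ (fun u => u - η * M) =ᵐ[uniformLaw a] id := by
      filter_upwards [ae_uniformLaw a] with u hu
      simp [truncate, hu]
    rw [Measure.map_congr this, Measure.map_id]
  · have : (fun e => truncate a (η * M + e)) ∘ (fun u => u + (M - η * M))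
        =ᵐ[uniformLaw a] fun _ => 0 := by
      filter_upwards [ae_uniformLaw a] with u hu
      have h1 : |M| ≤ |u + M| + |u| := by
        have := abs_sub (u + M) u
        simpa using this
      have : ¬ |u + M| ≤ a := by linarith
      simp [truncate, this, show η * M + (u + (M - η * M)) = u + M by ring]
    rw [Measure.map_congr this, Measure.map_const]
    simp

theorem isProbabilityMeasure_truncatedLaw (ha : 0 < a) (h0 : 0 ≤ η) (h1 : η ≤ 1) :
    IsProbabilityMeasure (truncatedLaw a η) := by
  have := isProbabilityMeasure_uniformLaw ha
  constructor
  rw [truncatedLaw, Measure.add_apply, Measure.smul_apply, Measure.smul_apply, measure_univ,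
    measure_univ, smul_eq_mul, smul_eq_mul, mul_one, mul_one,
    ← ENNReal.ofReal_add (by linarith) h0]
  simp

theorem truncatedLaw_singleton_zero : truncatedLaw a η {0} = ENNReal.ofReal η := by
  rw [truncatedLaw, Measure.add_apply, Measure.smul_apply, Measure.smul_apply,
    uniformLaw_absolutelyContinuous a Real.volume_singleton]
  simp

end HeavyTail

theorem measurable_lossTwo {Ω : Type*} [MeasurableSpace Ω] {f : ℝ → ℝ} (hf : Measurable f)
    {fhat : Ω → ℝ → ℝ} (h : Measurable (Function.uncurry fhat)) :
    Measurable fun y => lossTwo f (fhat y) := by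
  unfold lossTwo
  have : Measurable fun p : Ω × ℝ => ‖f p.2 - fhat p.1 p.2‖ₑ ^ 2 :=
    ((hf.comp measurable_snd).sub h).enorm.pow_const 2
  exact this.lintegral_prod_right'

theorem lossTwo_le_lossSup (f g : ℝ → ℝ) : lossTwo f g ≤ lossSup f g := by
  calc lossTwo f g ≤ ∫⁻ _ in Icc (0 : ℝ) 1, lossSup f g :=
        setLIntegral_mono' measurableSet_Icc fun t ht => by
          unfold lossSup
          gcongr
          exact le_iSup₂ (f := fun t _ => ‖f t - g t‖ₑ) t ht
    _ = lossSup f g := by simp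

theorem minimaxRisk_lossTwo_le_lossSup (F : Set (ℝ → ℝ)) (σ : ℝ) {n : ℕ} (x : Fin n → ℝ) (q : ℕ)
    (m₂ : ℝ≥0∞) : minimaxRisk lossTwo F σ x q m₂ ≤ minimaxRisk lossSup F σ x q m₂ := by
  unfold minimaxRisk risk
  gcongr
  exact lossTwo_le_lossSup _ _

/-- No prediction is close to both `d` and `-d`. -/
theorem two_mul_sq_le_enorm (d b : ℝ) :
    ENNReal.ofReal (2 * d ^ 2) ≤ ‖d - b‖ₑ ^ 2 + ‖-d - b‖ₑ ^ 2 := by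
  rw [Real.enorm_eq_ofReal_abs, Real.enorm_eq_ofReal_abs, ← ENNReal.ofReal_pow (abs_nonneg _),
    ← ENNReal.ofReal_pow (abs_nonneg _), ← ENNReal.ofReal_add (by positivity) (by positivity),
    sq_abs, sq_abs]
  exact ENNReal.ofReal_le_ofReal (by nlinarith [sq_nonneg b])

theorem lossTwo_const_add_lossTwo_neg (d : ℝ) {g : ℝ → ℝ} (hg : Measurable g) :
    ENNReal.ofReal (2 * d ^ 2) ≤ lossTwo (fun _ => d) g + lossTwo (fun _ => -d) g := by
  unfold lossTwo
  rw [← lintegral_add_left (by fun_prop)]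
  calc ENNReal.ofReal (2 * d ^ 2) = ∫⁻ _ in Icc (0 : ℝ) 1, ENNReal.ofReal (2 * d ^ 2) := by simp
    _ ≤ _ := lintegral_mono fun t => two_mul_sq_le_enorm d (g t)

/-- The samples with at most `q` zeros, which are those within reach of the adversary. -/
def fewZeros (n q : ℕ) : Set (Fin n → ℝ) := {z | (Finset.univ.filter fun i => z i = 0).card ≤ q}

theorem measurable_card_zeros (n : ℕ) :
    Measurable fun z : Fin n → ℝ => (Finset.univ.filter fun i => z i = 0).card := by
  simp_rw [Finset.card_filter]
  refine Finset.measurable_sum _ fun i _ => ?_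
  exact Measurable.ite ((measurable_pi_apply i) (measurableSet_singleton 0))
    measurable_const measurable_const

theorem measurableSet_fewZeros (n q : ℕ) : MeasurableSet (fewZeros n q) :=
  measurableSet_le (measurable_card_zeros n) measurable_const

/-- Markov's inequality: if zeros have probability `η` with `η n ≤ q / 2`, then more than `q` of
them occur with probability at most `1/2`. -/
theorem half_le_fewZeros {n q : ℕ} (R : Measure ℝ) [IsProbabilityMeasure R] {η : ℝ}
    (hR : R {0} = ENNReal.ofReal η) (hη : n * η ≤ q / 2) :
    1 / 2 ≤ (Measure.pi fun _ : Fin n => R) (fewZeros n q) := by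
  set P := Measure.pi fun _ : Fin n => R
  have hc : Measurable fun z : Fin n → ℝ =>
      (((Finset.univ.filter fun i => z i = 0).card : ℕ) : ℝ≥0∞) :=
    measurable_from_top.comp (measurable_card_zeros n)
  have h1 : ∫⁻ z, (((Finset.univ.filter fun i => z i = 0).card : ℕ) : ℝ≥0∞) ∂P
      = n * ENNReal.ofReal η := by
    have : ∀ z : Fin n → ℝ, (((Finset.univ.filter fun i => z i = 0).card : ℕ) : ℝ≥0∞)
        = ∑ i, ({0} : Set ℝ).indicator 1 (z i) := by
      intro z
      rw [Finset.card_filter]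
      push_cast
      exact Finset.sum_congr rfl fun i _ => by simp [Set.indicator_apply]
    simp_rw [this]
    have hm : ∀ i ∈ Finset.univ, Measurable fun z : Fin n → ℝ =>
        ({0} : Set ℝ).indicator (1 : ℝ → ℝ≥0∞) (z i) := fun i _ =>
      (measurable_one.indicator (measurableSet_singleton 0)).comp (measurable_pi_apply i)
    rw [lintegral_finsetSum _ hm]
    have : ∀ i : Fin n, ∫⁻ z, ({0} : Set ℝ).indicator 1 (z i) ∂P = ENNReal.ofReal η := by
      intro i
      rw [← hR, ← lintegral_indicator_one (μ := R) (measurableSet_singleton 0)]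
      exact (measurePreserving_eval (fun _ : Fin n => R) i).lintegral_comp
        (measurable_one.indicator (measurableSet_singleton 0))
    rw [Finset.sum_congr rfl fun i _ => this i]
    simp
  have h2 := mul_meas_ge_le_lintegral (μ := P) hc ((q + 1 : ℕ) : ℝ≥0∞)
  have h3 : {z : Fin n → ℝ | ((q + 1 : ℕ) : ℝ≥0∞) ≤
      (((Finset.univ.filter fun i => z i = 0).card : ℕ) : ℝ≥0∞)} = (fewZeros n q)ᶜ := by
    ext z
    simp only [fewZeros, mem_ofPred_eq, mem_compl_iff, Nat.cast_le]
    omega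
  rw [h3, h1] at h2
  have h4 : P (fewZeros n q)ᶜ ≤ 1 / 2 := by
    have h5 : (n : ℝ≥0∞) * ENNReal.ofReal η ≤ ((q + 1 : ℕ) : ℝ≥0∞) * (1 / 2) := by
      rw [← ENNReal.ofReal_natCast n, ← ENNReal.ofReal_mul (by positivity)]
      calc ENNReal.ofReal (n * η) ≤ ENNReal.ofReal ((q + 1 : ℕ) * (1 / 2)) := by
            refine ENNReal.ofReal_le_ofReal ?_
            push_cast
            linarith
        _ = _ := by
          rw [ENNReal.ofReal_mul (by positivity), ENNReal.ofReal_natCast]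
          congr 1
          rw [ENNReal.ofReal_div_of_pos (by norm_num)]
          simp
    exact (ENNReal.mul_le_mul_iff_right (by simp) (by simp)).1 (h2.trans h5)
  rw [prob_compl_eq_one_sub (measurableSet_fewZeros n q)] at h4
  have h5 : (1 : ℝ≥0∞) ≤ 1 / 2 + P (fewZeros n q) := tsub_le_iff_right.1 h4
  have h6 : (1 : ℝ≥0∞) - 1 / 2 ≤ P (fewZeros n q) := tsub_le_iff_left.2 h5
  simpa [ENNReal.one_sub_inv_two] using h6

/-- Truncation as an adversarial strategy for a constant regression function. -/
theorem le_risk_heavyTailLaw {n q : ℕ} {a η M : ℝ} (ha : 0 < a) (h0 : 0 ≤ η) (h1 : η ≤ 1)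
    (hM : 2 * a < |M|) (x : Fin n → ℝ) (m₂ : ℝ≥0∞) {fhat : (Fin n → ℝ) → ℝ → ℝ}
    (hf : Measurable (Function.uncurry fhat)) :
    ∫⁻ z, (fewZeros n q).indicator (fun z => lossTwo (fun _ => η * M) (fhat z)) z
        ∂(Measure.pi fun _ : Fin n => truncatedLaw a η)
      ≤ risk lossTwo x q m₂ (heavyTailLaw a η M) (fun _ => η * M) fhat := by
  have := isProbabilityMeasure_heavyTailLaw (M := M) ha h0 h1
  have hT : Measurable fun e => truncate a (η * M + e) :=
    (measurable_truncate a).comp (measurable_const_add _)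
  have := Measure.isProbabilityMeasure_map (μ := heavyTailLaw a η M) hT.aemeasurable
  have hmap := Measure.pi_map_pi (μ := fun _ : Fin n => heavyTailLaw a η M)
      (f := fun _ e => truncate a (η * M + e)) fun i => hT.aemeasurable
  rw [map_truncate_heavyTailLaw ha hM] at hmap
  have hTn : Measurable fun (ε : Fin n → ℝ) i => truncate a (η * M + ε i) :=
    measurable_pi_lambda _ fun i => hT.comp (measurable_pi_apply i)
  rw [← hmap, lintegral_map ((measurable_lossTwo measurable_const hf).indicator
    (measurableSet_fewZeros n q)) hTn]
  refine lintegral_mono fun ε => ?_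
  by_cases h : (fun i => truncate a (η * M + ε i)) ∈ fewZeros n q
  · rw [Set.indicator_of_mem h]
    refine le_iSup₂ (f := fun y _ => lossTwo (fun _ => η * M) (fhat y)) _
      ⟨Finset.univ.filter fun i => truncate a (η * M + ε i) = 0, h, ?_, ?_⟩
    · intro i hi
      have hi' : truncate a (η * M + ε i) ≠ 0 := by simpa using hi
      by_contra hne
      refine hi' (if_neg fun hle => hne ?_)
      exact if_pos hle
    · intro i hi
      have hi' : truncate a (η * M + ε i) = 0 := by simpa using hi
      simp [hi']
  · rw [Set.indicator_of_notMem h]; exact zero_le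

/-- The constant regression functions `η M` and `-η M` cannot be told apart. -/
theorem le_minimaxRisk_of_heavyTail {n q : ℕ} {F : Set (ℝ → ℝ)} {σ a η M : ℝ} (ha : 0 < a)
    (h0 : 0 ≤ η) (h1 : η ≤ 1) (hM : 2 * a < |M|)
    (hσ : a ^ 2 / 3 + η * (1 - η) * M ^ 2 = σ ^ 2) (hη : n * η ≤ q / 2)
    (hF : (fun _ => η * M) ∈ F) (hF' : (fun _ => -(η * M)) ∈ F) (x : Fin n → ℝ) (m₂ : ℝ≥0∞) :
    ENNReal.ofReal ((η * M) ^ 2 / 2) ≤ minimaxRisk lossTwo F σ x q m₂ := by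
  refine le_iInf₂ fun fhat hf => ?_
  set S := ⨆ (f ∈ F) (ν : Measure ℝ) (_ : IsNoiseLaw σ ν), risk lossTwo x q m₂ ν f fhat with hS
  have hle : ∀ f ∈ F, ∀ ν, IsNoiseLaw σ ν → risk lossTwo x q m₂ ν f fhat ≤ S :=
    fun f hfF ν hν => le_iSup₂_of_le f hfF (le_iSup₂_of_le ν hν le_rfl)
  have hp := (le_risk_heavyTailLaw (q := q) ha h0 h1 hM x m₂ hf).trans
    (hle _ hF _ (isNoiseLaw_heavyTailLaw ha h0 h1 hσ))
  have hn := (le_risk_heavyTailLaw (q := q) (M := -M) ha h0 h1 (by simpa using hM) x m₂ hf).trans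
    (hle _ (by simpa using hF') _ (isNoiseLaw_heavyTailLaw ha h0 h1 (by simpa using hσ)))
  have := isProbabilityMeasure_truncatedLaw ha h0 h1
  -- One truncated law serves both signs: it does not depend on `M`.
  have hG := half_le_fewZeros (truncatedLaw a η) truncatedLaw_singleton_zero hη
  set P := Measure.pi fun _ : Fin n => truncatedLaw a η
  have hsum : ENNReal.ofReal (2 * (η * M) ^ 2) * (1 / 2) ≤ S + S := by
    calc ENNReal.ofReal (2 * (η * M) ^ 2) * (1 / 2)
        ≤ ENNReal.ofReal (2 * (η * M) ^ 2) * P (fewZeros n q) := by gcongr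
      _ = ∫⁻ z, (fewZeros n q).indicator (fun _ => ENNReal.ofReal (2 * (η * M) ^ 2)) z ∂P := by
          rw [lintegral_indicator_const (measurableSet_fewZeros n q)]
      _ ≤ ∫⁻ z, ((fewZeros n q).indicator (fun z => lossTwo (fun _ => η * M) (fhat z)) z
            + (fewZeros n q).indicator (fun z => lossTwo (fun _ => η * -M) (fhat z)) z) ∂P := by
          refine lintegral_mono fun z => ?_
          by_cases h : z ∈ fewZeros n q
          · simp only [Set.indicator_of_mem h, mul_neg]
            exact lossTwo_const_add_lossTwo_neg _ (hf.comp measurable_prodMk_left)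
          · simp [Set.indicator_of_notMem h]
      _ ≤ S + S := by
          rw [lintegral_add_left ((measurable_lossTwo measurable_const hf).indicator
            (measurableSet_fewZeros n q))]
          exact add_le_add hp hn
  have h2 : ENNReal.ofReal (2 * (η * M) ^ 2) * (1 / 2)
      = 2 * ENNReal.ofReal ((η * M) ^ 2 / 2) := by
    rw [show 2 * (η * M) ^ 2 = 2 * (2 * ((η * M) ^ 2 / 2)) by ring, ENNReal.ofReal_mul (by norm_num),
      ENNReal.ofReal_mul (by norm_num), ENNReal.ofReal_ofNat, mul_comm, ← mul_assoc, one_div,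
      ENNReal.inv_mul_cancel (by simp) (by simp), one_mul]
  rw [h2, ← two_mul] at hsum
  exact (ENNReal.mul_le_mul_iff_right (by simp) (by simp)).1 hsum

/-- The rate `q / n` for the integrated squared error under contamination. -/
theorem exists_le_minimaxRisk_contamination {σ μ : ℝ} (hσ : 0 < σ) (hμ0 : 0 < μ) {L m₁ : ℝ≥0∞}
    (hμ : ENNReal.ofReal μ ≤ m₁) : ∃ c : ℝ, 0 < c ∧ ∀ n q : ℕ, 1 ≤ n → q ≤ n →
      ∀ (x : Fin n → ℝ) (m₂ : ℝ≥0∞), ENNReal.ofReal (c * ((q : ℝ) / n)) ≤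
        minimaxRisk lossTwo (sobolevClass L m₁) σ x q m₂ := by
  set κ := min (1 / 16) (μ ^ 2 / σ ^ 2) with hκ
  have hκ0 : 0 < κ := by positivity
  have hκ1 : κ ≤ 1 / 16 := min_le_left _ _
  have hκ2 : κ * σ ^ 2 ≤ μ ^ 2 := (le_div_iff₀ (by positivity)).1 (min_le_right _ _)
  refine ⟨κ * σ ^ 2 / 4, by positivity, fun n q hn hqn x m₂ => ?_⟩
  have hn0 : (0 : ℝ) < n := by exact_mod_cast hn
  rcases Nat.eq_zero_or_pos q with rfl | hq
  · simp
  have hq0 : (0 : ℝ) < q := by exact_mod_cast hq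
  have hr0 : 0 < (q : ℝ) / n := by positivity
  have hr1 : (q : ℝ) / n ≤ 1 := (div_le_one hn0).2 (by exact_mod_cast hqn)
  set η := κ * ((q : ℝ) / n) with hη
  have hη0 : 0 < η := by positivity
  have hη1 : η ≤ 1 / 16 := by nlinarith
  -- The base takes half of the variance, the tail the other half.
  set a := √(3 / 2) * σ
  set M := σ / √(2 * η * (1 - η)) with hM
  have hprod : 0 < 2 * η * (1 - η) := by
    have : 0 < 1 - η := by linarith
    positivity
  have ha : 0 < a := by positivity
  have ha2 : a ^ 2 = 3 / 2 * σ ^ 2 := by rw [mul_pow, Real.sq_sqrt (by norm_num)]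
  have hM2 : M ^ 2 * (2 * η * (1 - η)) = σ ^ 2 := by
    rw [hM, div_pow, Real.sq_sqrt hprod.le, div_mul_cancel₀ _ hprod.ne']
  have hM0 : 0 < M := by positivity
  have hMbig : 2 * a < |M| := by
    rw [abs_of_pos hM0]
    refine lt_of_pow_lt_pow_left₀ 2 hM0.le ?_
    rw [mul_pow, ha2]
    nlinarith [sq_nonneg M, sq_nonneg η, mul_pos hη0 (pow_pos hM0 2), pow_pos hσ 2]
  have hdelta : |η * M| ≤ μ := by
    refine abs_le_of_sq_le_sq ?_ hμ0.le
    have h1 : (η * M) ^ 2 ≤ η * σ ^ 2 := by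
      rw [← hM2]
      have := mul_pos hη0 (mul_pos hη0 (pow_pos hM0 2))
      nlinarith
    have h2 : η * σ ^ 2 ≤ κ * σ ^ 2 := by
      gcongr
      exact mul_le_of_le_one_right hκ0.le hr1
    linarith
  refine le_trans (ENNReal.ofReal_le_ofReal ?_) (le_minimaxRisk_of_heavyTail (σ := σ) ha hη0.le
    (by linarith) hMbig ?_ ?_ (const_mem_sobolevClass hdelta hμ)
    (const_mem_sobolevClass ((abs_neg _).trans_le hdelta) hμ) x m₂)
  · have h1 : η * σ ^ 2 ≤ 2 * (η * M) ^ 2 := by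
      rw [← hM2]
      have := mul_pos hη0 (mul_pos hη0 (pow_pos hM0 2))
      nlinarith
    have : κ * σ ^ 2 / 4 * ((q : ℝ) / n) = η * σ ^ 2 / 4 := by rw [hη]; ring
    linarith
  · rw [ha2]; linarith
  · have : n * η = κ * q := by rw [hη]; field_simp
    rw [this]
    nlinarith

end

/-! ### Many bumps: the integrated loss -/

section

theorem isNoiseLaw_gaussianReal {σ : ℝ} (hσ : 0 < σ) :
    IsNoiseLaw σ (gaussianReal 0 (σ ^ 2).toNNReal) := by
  have hv : (σ ^ 2).toNNReal ≠ 0 := by simpa using hσ.ne'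
  refine ⟨inferInstance, gaussianReal_absolutelyContinuous 0 hv, memLp_id_gaussianReal 2,
    integral_id_gaussianReal, ?_⟩
  rw [variance_id_gaussianReal, Real.coe_toNNReal _ (sq_nonneg σ)]

/-- An adversary that does nothing. -/
theorem lintegral_loss_le_risk (loss : (ℝ → ℝ) → (ℝ → ℝ) → ℝ≥0∞) {n : ℕ} (x : Fin n → ℝ) (q : ℕ)
    (m₂ : ℝ≥0∞) (ν : Measure ℝ) (f : ℝ → ℝ) (fhat : (Fin n → ℝ) → ℝ → ℝ) :
    ∫⁻ ε, loss f (fhat ((fun i => f (x i)) + ε)) ∂(Measure.pi fun _ : Fin n => ν)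
      ≤ risk loss x q m₂ ν f fhat :=
  lintegral_mono fun ε => le_iSup₂ (f := fun y _ => loss f (fhat y)) _
    ⟨∅, by simp, fun _ _ => rfl, by simp⟩

/-- Two hypotheses with Gaussian noise whose means are `√(v log 2)`-close: no procedure has small
expected loss under both. -/
theorem half_le_lintegral_add_of_shift {n : ℕ} {v : NNReal} (hv : v ≠ 0) {u u' : Fin n → ℝ}
    (h : ∑ i, (u' i - u i) * (u' i - u i) / v ≤ Real.log 2) {D D' : (Fin n → ℝ) → ℝ≥0∞}
    (hD : Measurable D) (hD' : Measurable D') {s : ℝ≥0∞} (hs : ∀ y, s ≤ D y + D' y) :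
    s * (1 / 2) ≤ ∫⁻ ε, D (u + ε) ∂gaussianNoise v n + ∫⁻ ε, D' (u' + ε) ∂gaussianNoise v n := by
  have hm := measurable_likelihoodRatio v (u' - u)
  have h1 : ∫⁻ ε, D' (u' + ε) ∂gaussianNoise v n
      = ∫⁻ ε, likelihoodRatio v (u' - u) ε * D' (u + ε) ∂gaussianNoise v n := by
    rw [← lintegral_add_gaussianNoise hv (u' - u) (g := fun ε => D' (u + ε))
      (hD'.comp (measurable_const_add u))]
    congr with ε
    congr 1
    abel
  have hDu : Measurable fun ε => D (u + ε) := hD.comp (measurable_const_add u)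
  rw [h1, ← lintegral_add_left hDu]
  have h2 : ∫⁻ ε, likelihoodRatio v (u' - u) ε * likelihoodRatio v (u' - u) ε ∂gaussianNoise v n
      ≤ 2 := by
    rw [lintegral_likelihoodRatio_mul hv]
    calc _ ≤ ENNReal.ofReal (Real.exp (Real.log 2)) := by
          gcongr; exact h
      _ = 2 := by rw [Real.exp_log (by norm_num)]; simp
  calc s * (1 / 2) ≤ s * ∫⁻ ε, min 1 (likelihoodRatio v (u' - u) ε) ∂gaussianNoise v n := by
        gcongr
        exact half_le_lintegral_min_one _ hm (lintegral_likelihoodRatio hv _) h2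
    _ = ∫⁻ ε, s * min 1 (likelihoodRatio v (u' - u) ε) ∂gaussianNoise v n :=
        (lintegral_const_mul _ (measurable_const.min hm)).symm
    _ ≤ _ := by
        refine lintegral_mono fun ε => ?_
        rw [mul_comm]
        calc _ ≤ min 1 (likelihoodRatio v (u' - u) ε) * (D (u + ε) + D' (u + ε)) := by
              gcongr; exact hs _
          _ ≤ 1 * D (u + ε) + likelihoodRatio v (u' - u) ε * D' (u + ε) := by
              rw [mul_add]
              gcongr
              · exact min_le_left _ _
              · exact min_le_right _ _
          _ = _ := by rw [one_mul]

open Classical in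
/-- The number of design points in the `j`-th bin. -/
noncomputable def binCount {n m : ℕ} (x : Fin n → ℝ) (j : Fin m) : ℕ :=
  (Finset.univ.filter fun i => x i ∈ bin j).card

/-- The bins that hold at most twice the average number of design points. -/
noncomputable def goodBins {n : ℕ} (m : ℕ) (x : Fin n → ℝ) : Finset (Fin m) :=
  Finset.univ.filter fun j => binCount x j * m ≤ 2 * n

/-- The bins are disjoint. -/
theorem sum_binCount_le {n m : ℕ} (x : Fin n → ℝ) : ∑ j : Fin m, binCount x j ≤ n := by
  classical
  simp only [binCount, Finset.card_filter]
  rw [Finset.sum_comm]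
  calc _ ≤ ∑ _ : Fin n, 1 := by
        refine Finset.sum_le_sum fun i _ => ?_
        rw [← Finset.card_filter, Finset.card_le_one]
        intro j hj k hk
        exact bin_disjoint (by simpa using hj) (by simpa using hk)
    _ = n := by simp

/-- At least half of the bins are good. -/
theorem le_two_mul_card_goodBins {n : ℕ} (hn : 1 ≤ n) (m : ℕ) (x : Fin n → ℝ) :
    m ≤ 2 * (goodBins m x).card := by
  have h1 : ((Finset.univ \ goodBins m x).card) * (2 * n) ≤ n * m := by
    calc _ = ∑ _ ∈ Finset.univ \ goodBins m x, 2 * n := by simp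
      _ ≤ ∑ j ∈ Finset.univ \ goodBins m x, binCount x j * m := by
          refine Finset.sum_le_sum fun j hj => ?_
          simp only [goodBins, Finset.mem_sdiff, Finset.mem_univ, Finset.mem_filter, true_and,
            not_le] at hj
          exact hj.le
      _ ≤ ∑ j, binCount x j * m :=
          Finset.sum_le_sum_of_subset (Finset.subset_univ _)
      _ ≤ n * m := by
          rw [← Finset.sum_mul]
          exact Nat.mul_le_mul_right _ (sum_binCount_le x)
  have h2 : 2 * (Finset.univ \ goodBins m x).card ≤ m := by
    refine Nat.le_of_mul_le_mul_left (c := n) ?_ hn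
    linarith
  have h3 := Finset.card_sdiff_add_card_eq_card (Finset.subset_univ (goodBins m x))
  simp only [Finset.card_univ, Fintype.card_fin] at h3
  omega

variable {m : ℕ}

theorem bump_zero_of_half_le (s : ℝ) (hs : 1 / 2 ≤ |s|) : bump s = 0 :=
  eq_zero_of_tsupport_subset tsupport_bump s hs

theorem bumpSum_single {g : ℝ → ℝ} (j : Fin m) (a t : ℝ) :
    bumpSum g (Pi.single j a) t = a * g (m * t - j - 1 / 2) := by
  unfold bumpSum
  rw [Finset.sum_eq_single j (fun k _ hk => by simp [Pi.single_eq_of_ne hk]) (by simp)]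
  simp

/-- The signal-to-noise ratio of a single bump is at most `a² / v` for each design point it
covers. -/
theorem sum_bumpSum_single_le {n : ℕ} {v : NNReal} (x : Fin n → ℝ) (j : Fin m) (a : ℝ) :
    ∑ i, bumpSum bump (Pi.single j a) (x i) * bumpSum bump (Pi.single j a) (x i) / v
      ≤ a ^ 2 * binCount x j / v := by
  classical
  calc _ ≤ ∑ i, (if x i ∈ bin j then a ^ 2 / v else 0) := by
        refine Finset.sum_le_sum fun i _ => ?_
        rw [bumpSum_single]
        split_ifs with h
        · have h1 := bump.le_one (x := m * x i - j - 1 / 2)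
          have h0 := bump.nonneg (x := m * x i - j - 1 / 2)
          gcongr
          nlinarith [mul_le_one₀ h1 h0 h1, sq_nonneg a]
        · rw [bump_zero_of_half_le _ (not_lt.1 h)]
          simp
    _ = _ := by
        rw [← Finset.sum_filter, Finset.sum_const, nsmul_eq_mul]
        simp only [binCount]
        ring

theorem binCount_div_le {n : ℕ} {x : Fin n → ℝ} {j : Fin m} (hj : j ∈ goodBins m x) {a v : ℝ}
    (hv : 0 < v) : a ^ 2 * binCount x j / v ≤ a ^ 2 * (2 * n) / (m * v) := by
  have hm : (0 : ℝ) < m := by exact_mod_cast j.pos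
  have h : (binCount x j : ℝ) * m ≤ 2 * n := by
    have := (Finset.mem_filter.1 hj).2
    exact_mod_cast this
  rw [div_le_div_iff₀ hv (by positivity)]
  calc a ^ 2 * binCount x j * (m * v) = a ^ 2 * v * (binCount x j * m) := by ring
    _ ≤ a ^ 2 * v * (2 * n) := by gcongr
    _ = _ := by ring

/-- The middle half of the `j`-th bin, on which the bump is constant. -/
def plateau (j : Fin m) : Set ℝ := Icc ((j + 1 / 4) / m) ((j + 3 / 4) / m)

theorem mem_plateau_iff {j : Fin m} {t : ℝ} : t ∈ plateau j ↔ |m * t - j - 1 / 2| ≤ 1 / 4 := by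
  have : (0 : ℝ) < m := by exact_mod_cast j.pos
  simp only [plateau, mem_Icc, abs_le, div_le_iff₀ this, le_div_iff₀ this]
  constructor <;> rintro ⟨h, h'⟩ <;> constructor <;> linarith

theorem plateau_subset_bin (j : Fin m) : plateau j ⊆ bin j := fun t ht => by
  have := mem_plateau_iff.1 ht
  rw [bin, mem_ofPred_eq]
  linarith

theorem bin_subset_Icc (j : Fin m) : bin j ⊆ Icc (0 : ℝ) 1 := by
  have hm : (0 : ℝ) < m := by exact_mod_cast j.pos
  have hj : (j : ℝ) + 1 ≤ m := by exact_mod_cast j.2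
  rw [bin_eq_Ioo]
  refine Ioo_subset_Icc_self.trans (Icc_subset_Icc (by positivity) ((div_le_one hm).2 hj))

theorem volume_plateau (j : Fin m) : volume (plateau j) = ENNReal.ofReal (1 / (2 * m)) := by
  have hm : (0 : ℝ) < m := by exact_mod_cast j.pos
  rw [plateau, Real.volume_Icc]
  congr 1
  field_simp
  ring

theorem bumpSum_bump_of_mem_plateau {θ : Fin m → ℝ} {j : Fin m} {t : ℝ} (ht : t ∈ plateau j) :
    bumpSum bump θ t = θ j := by
  rw [bumpSum_eq_of_mem bump_zero_of_half_le (plateau_subset_bin j ht),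
    bump_eq_one (mem_plateau_iff.1 ht), mul_one]

/-- The loss of predicting `g` where the truth is `c`, on the middle half of the `j`-th bin. -/
noncomputable def plateauLoss (j : Fin m) (c : ℝ) (g : ℝ → ℝ) : ℝ≥0∞ :=
  ∫⁻ t in plateau j, ‖c - g t‖ₑ ^ 2

theorem measurable_plateauLoss {Ω : Type*} [MeasurableSpace Ω] (j : Fin m) (c : ℝ)
    {fhat : Ω → ℝ → ℝ} (h : Measurable (Function.uncurry fhat)) :
    Measurable fun y => plateauLoss j c (fhat y) := by
  unfold plateauLoss
  have : Measurable fun p : Ω × ℝ => ‖c - fhat p.1 p.2‖ₑ ^ 2 :=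
    (measurable_const.sub h).enorm.pow_const 2
  exact this.lintegral_prod_right'

theorem sum_plateauLoss_le_lossTwo (θ : Fin m → ℝ) (J : Finset (Fin m)) (g : ℝ → ℝ) :
    ∑ j ∈ J, plateauLoss j (θ j) g ≤ lossTwo (bumpSum bump θ) g := by
  have h1 : ∀ j, plateauLoss j (θ j) g = ∫⁻ t in plateau j, ‖bumpSum bump θ t - g t‖ₑ ^ 2 := by
    intro j
    refine setLIntegral_congr_fun measurableSet_Icc fun t ht => ?_
    simp only [bumpSum_bump_of_mem_plateau ht]
  simp_rw [h1]
  rw [← lintegral_biUnion_finset (fun j _ k _ hjk => Set.disjoint_left.2 fun t hj hk =>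
    hjk (bin_disjoint (plateau_subset_bin j hj) (plateau_subset_bin k hk)))
    fun j _ => measurableSet_Icc]
  exact lintegral_mono_set (iUnion₂_subset fun j _ => (plateau_subset_bin j).trans
    (bin_subset_Icc j))

/-- No prediction is close to both `a` and `0`. -/
theorem half_sq_le_enorm (a b : ℝ) :
    ENNReal.ofReal (a ^ 2 / 2) ≤ ‖a - b‖ₑ ^ 2 + ‖0 - b‖ₑ ^ 2 := by
  rw [Real.enorm_eq_ofReal_abs, Real.enorm_eq_ofReal_abs, ← ENNReal.ofReal_pow (abs_nonneg _),
    ← ENNReal.ofReal_pow (abs_nonneg _), ← ENNReal.ofReal_add (by positivity) (by positivity),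
    sq_abs, sq_abs]
  exact ENNReal.ofReal_le_ofReal (by nlinarith [sq_nonneg (a - 2 * b)])

theorem le_plateauLoss_add (j : Fin m) (a : ℝ) {g : ℝ → ℝ} (hg : Measurable g) :
    ENNReal.ofReal (a ^ 2 / 2 * (1 / (2 * m))) ≤ plateauLoss j a g + plateauLoss j 0 g := by
  unfold plateauLoss
  rw [← lintegral_add_left (by fun_prop)]
  calc _ = ∫⁻ _ in plateau j, ENNReal.ofReal (a ^ 2 / 2) := by
        rw [setLIntegral_const, volume_plateau, ENNReal.ofReal_mul (by positivity)]
    _ ≤ _ := lintegral_mono fun t => half_sq_le_enorm a (g t)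

/-- The weights of the hypothesis indexed by `b`: `a` or `0` in every bin. -/
def weights (a : ℝ) (b : Fin m → Bool) (j : Fin m) : ℝ := if b j then a else 0

/-- The hypothesis with the `j`-th bit reversed. -/
def flipBit (j : Fin m) : (Fin m → Bool) ≃ (Fin m → Bool) :=
  Function.Involutive.toPerm (fun b => Function.update b j (!b j)) fun b => by simp

/-- Hypotheses that differ in one bit differ by a single bump. -/
theorem bumpSum_flipBit (g : ℝ → ℝ) (a : ℝ) (b : Fin m → Bool) (j : Fin m) (t : ℝ) :
    bumpSum g (weights a (flipBit j b)) t - bumpSum g (weights a b) t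
      = bumpSum g (Pi.single j (weights a (flipBit j b) j - weights a b j)) t := by
  unfold bumpSum
  rw [← Finset.sum_sub_distrib]
  refine Finset.sum_congr rfl fun k _ => ?_
  rw [← sub_mul]
  congr 1
  rcases eq_or_ne k j with rfl | h
  · simp
  · rw [Pi.single_eq_of_ne h]
    have : flipBit j b k = b k := Function.update_of_ne h _ _
    simp [weights, this]

theorem flipBit_self (j : Fin m) (b : Fin m → Bool) : flipBit j b j = !b j :=
  Function.update_self _ _ _

/-- The loss in one good bin, averaged over all hypotheses: they are paired off by reversing the bit
of that bin. -/
theorem le_sum_plateauLoss {n : ℕ} {v : NNReal} (hv : v ≠ 0) {x : Fin n → ℝ} {a : ℝ}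
    (ha : a ^ 2 * (2 * n) / (m * v) ≤ Real.log 2) {j : Fin m} (hj : j ∈ goodBins m x)
    {fhat : (Fin n → ℝ) → ℝ → ℝ} (hf : Measurable (Function.uncurry fhat)) :
    2 ^ m * (ENNReal.ofReal (a ^ 2 / 2 * (1 / (2 * m))) * (1 / 2))
      ≤ 2 * ∑ b : Fin m → Bool, ∫⁻ ε, plateauLoss j (weights a b j)
        (fhat ((fun i => bumpSum bump (weights a b) (x i)) + ε)) ∂gaussianNoise v n := by
  set E : (Fin m → Bool) → ℝ≥0∞ := fun b => ∫⁻ ε, plateauLoss j (weights a b j)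
        (fhat ((fun i => bumpSum bump (weights a b) (x i)) + ε)) ∂gaussianNoise v n with hE
  have hpair : ∀ b, ENNReal.ofReal (a ^ 2 / 2 * (1 / (2 * m))) * (1 / 2)
      ≤ E b + E (flipBit j b) := by
    intro b
    have hsq : (weights a (flipBit j b) j - weights a b j) ^ 2 = a ^ 2 := by
      rw [weights, weights, flipBit_self]
      cases b j <;> simp
    refine half_le_lintegral_add_of_shift hv ?_
      (measurable_plateauLoss j _ hf) (measurable_plateauLoss j _ hf) ?_
    · simp only [bumpSum_flipBit]
      refine (sum_bumpSum_single_le x j _).trans ?_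
      rw [hsq]
      exact (binCount_div_le hj (by positivity)).trans ha
    · intro y
      have : ENNReal.ofReal (a ^ 2 / 2 * (1 / (2 * m)))
          ≤ plateauLoss j a (fhat y) + plateauLoss j 0 (fhat y) :=
        le_plateauLoss_add j a (hf.comp measurable_prodMk_left)
      rw [weights, weights, flipBit_self]
      cases b j
      · simpa [add_comm] using this
      · simpa using this
  calc _ = ∑ _ : Fin m → Bool, ENNReal.ofReal (a ^ 2 / 2 * (1 / (2 * m))) * (1 / 2) := by
        simp
    _ ≤ ∑ b, (E b + E (flipBit j b)) := Finset.sum_le_sum fun b _ => hpair b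
    _ = 2 * ∑ b, E b := by
        rw [Finset.sum_add_distrib, Equiv.sum_comp (flipBit j) E, two_mul]

/-- The worst-case risk is at least that under Gaussian noise and an idle adversary. -/
theorem le_iSup_risk {loss : (ℝ → ℝ) → (ℝ → ℝ) → ℝ≥0∞} {F : Set (ℝ → ℝ)} {σ : ℝ} (hσ : 0 < σ)
    {n : ℕ} (x : Fin n → ℝ) (q : ℕ) (m₂ : ℝ≥0∞) (fhat : (Fin n → ℝ) → ℝ → ℝ) {f : ℝ → ℝ}
    (hf : f ∈ F) :
    ∫⁻ ε, loss f (fhat ((fun i => f (x i)) + ε)) ∂gaussianNoise (σ ^ 2).toNNReal n ≤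
      ⨆ (f ∈ F) (ν : Measure ℝ) (_ : IsNoiseLaw σ ν), risk loss x q m₂ ν f fhat :=
  (lintegral_loss_le_risk loss x q m₂ _ f fhat).trans
    (le_iSup₂_of_le f hf (le_iSup₂_of_le _ (isNoiseLaw_gaussianReal hσ) le_rfl))

/-- Assouad's lemma for bumps of height `a` in `m` bins. -/
theorem le_minimaxRisk_lossTwo_of_bumps {F : Set (ℝ → ℝ)} {σ : ℝ} (hσ : 0 < σ) {n q : ℕ}
    (hn : 1 ≤ n) (x : Fin n → ℝ) (m₂ : ℝ≥0∞) (hm : 0 < m) {a : ℝ}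
    (hF : ∀ b : Fin m → Bool, bumpSum bump (weights a b) ∈ F)
    (ha : a ^ 2 * (2 * n) / (m * σ ^ 2) ≤ Real.log 2) :
    ENNReal.ofReal (a ^ 2 / 32) ≤ minimaxRisk lossTwo F σ x q m₂ := by
  refine le_iInf₂ fun fhat hf => ?_
  set S := ⨆ (f ∈ F) (ν : Measure ℝ) (_ : IsNoiseLaw σ ν), risk lossTwo x q m₂ ν f fhat with hS
  have hv : (σ ^ 2).toNNReal ≠ 0 := by simpa using hσ.ne'
  have hvc : (((σ ^ 2).toNNReal : NNReal) : ℝ) = σ ^ 2 := Real.coe_toNNReal _ (sq_nonneg σ)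
  set s := ENNReal.ofReal (a ^ 2 / 2 * (1 / (2 * m))) * (1 / 2) with hs
  have hm0 : (0 : ℝ) < m := by exact_mod_cast hm
  have h1 : 2 ^ m * ((goodBins m x).card * s) ≤ 2 ^ m * (2 * S) := by
    calc 2 ^ m * ((goodBins m x).card * s) = ∑ _ ∈ goodBins m x, 2 ^ m * s := by
          rw [Finset.sum_const, nsmul_eq_mul]; ring
      _ ≤ ∑ j ∈ goodBins m x, 2 * ∑ b : Fin m → Bool, ∫⁻ ε, plateauLoss j (weights a b j)
          (fhat ((fun i => bumpSum bump (weights a b) (x i)) + ε))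
            ∂gaussianNoise (σ ^ 2).toNNReal n :=
          Finset.sum_le_sum fun j hj => le_sum_plateauLoss hv (by rw [hvc]; exact ha) hj hf
      _ = 2 * ∑ b : Fin m → Bool, ∫⁻ ε, ∑ j ∈ goodBins m x, plateauLoss j (weights a b j)
          (fhat ((fun i => bumpSum bump (weights a b) (x i)) + ε))
            ∂gaussianNoise (σ ^ 2).toNNReal n := by
          rw [← Finset.mul_sum, Finset.sum_comm]
          congr 1
          refine Finset.sum_congr rfl fun b _ => ?_
          rw [lintegral_finsetSum]
          exact fun j _ => (measurable_plateauLoss j _ hf).comp (measurable_const_add _)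
      _ ≤ 2 * ∑ _ : Fin m → Bool, S := by
          gcongr with b
          refine le_trans (lintegral_mono fun ε => ?_) (le_iSup_risk hσ x q m₂ fhat (hF b))
          exact sum_plateauLoss_le_lossTwo _ _ _
      _ = 2 ^ m * (2 * S) := by simp; ring
  have h2 : (goodBins m x).card * s ≤ 2 * S :=
    (ENNReal.mul_le_mul_iff_right (by simp) (by simp)).1 h1
  have h3 : 2 * ENNReal.ofReal (a ^ 2 / 32) ≤ (goodBins m x).card * s := by
    have hhalf : (1 / 2 : ℝ≥0∞) = ENNReal.ofReal (1 / 2) := by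
      rw [ENNReal.ofReal_div_of_pos (by norm_num)]; simp
    rw [hs, hhalf, ← ENNReal.ofReal_mul (by positivity), ← ENNReal.ofReal_natCast,
      ← ENNReal.ofReal_mul (by positivity), ← ENNReal.ofReal_ofNat 2,
      ← ENNReal.ofReal_mul (by positivity)]
    refine ENNReal.ofReal_le_ofReal ?_
    have hc : (m : ℝ) ≤ 2 * (goodBins m x).card := by
      exact_mod_cast le_two_mul_card_goodBins hn m x
    calc 2 * (a ^ 2 / 32) = m / 2 * (a ^ 2 / 2 * (1 / (2 * m)) * (1 / 2)) := by
          field_simp; ring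
      _ ≤ _ := by gcongr; linarith
  exact (ENNReal.mul_le_mul_iff_right (by simp) (by simp)).1 (h3.trans h2)

/-- The rate `n ^ (-4/5)` for the integrated loss: `n ^ (1/5)` bins, rounded up. -/
theorem exists_le_minimaxRisk_lossTwo {σ ℓ μ : ℝ} (hσ : 0 < σ) (hℓ0 : 0 < ℓ) (hμ0 : 0 < μ)
    {L m₁ : ℝ≥0∞} (hℓ : ENNReal.ofReal ℓ ≤ L) (hμ : ENNReal.ofReal μ ≤ m₁) :
    ∃ c : ℝ, 0 < c ∧ ∀ n q : ℕ, 1 ≤ n → ∀ (x : Fin n → ℝ) (m₂ : ℝ≥0∞),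
      ENNReal.ofReal (c * (1 / (n : ℝ) ^ (4 / 5 : ℝ))) ≤
        minimaxRisk lossTwo (sobolevClass L m₁) σ x q m₂ := by
  obtain ⟨K, hK0, hK⟩ := exists_bound_deriv_deriv_bump
  set α := min (ℓ / K) (min μ (σ / 2)) with hα
  have hα0 : 0 < α := by positivity
  have hα1 : K * α ≤ ℓ := by
    rw [mul_comm]; exact (le_div_iff₀ hK0).1 (min_le_left _ _)
  have hα2 : α ≤ μ := (min_le_right _ _).trans (min_le_left _ _)
  have hα3 : α ≤ σ / 2 := (min_le_right _ _).trans (min_le_right _ _)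
  refine ⟨α ^ 2 / 512, by positivity, fun n q hn x m₂ => ?_⟩
  have hn0 : (1 : ℝ) ≤ n := by exact_mod_cast hn
  set T := (n : ℝ) ^ (1 / 5 : ℝ) with hT
  have hT1 : 1 ≤ T := Real.one_le_rpow hn0 (by norm_num)
  have hT5 : T ^ 5 = n := by
    rw [hT, ← Real.rpow_natCast, ← Real.rpow_mul (by positivity)]; simp
  have hT4 : (n : ℝ) ^ (4 / 5 : ℝ) = T ^ 4 := by
    rw [hT, ← Real.rpow_natCast, ← Real.rpow_mul (by positivity)]; norm_num
  set m := ⌈T⌉₊ with hm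
  have hmT : T ≤ m := Nat.le_ceil T
  have hm0 : (1 : ℝ) ≤ m := hT1.trans hmT
  have hm2 : (m : ℝ) ≤ 2 * T := by linarith [Nat.ceil_lt_add_one (zero_le_one.trans hT1)]
  have hmpos : 0 < m := by exact_mod_cast (zero_lt_one.trans_le hm0)
  have hα4 : α / m ^ 2 ≤ α := div_le_self hα0.le (one_le_pow₀ hm0)
  refine le_trans (ENNReal.ofReal_le_ofReal ?_)
    (le_minimaxRisk_lossTwo_of_bumps (a := α / m ^ 2) hσ hn x m₂ hmpos ?_ ?_)
  · have h4 : (m : ℝ) ^ 4 ≤ 16 * T ^ 4 := by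
      calc (m : ℝ) ^ 4 ≤ (2 * T) ^ 4 := by gcongr
        _ = _ := by ring
    rw [hT4, div_pow, ← pow_mul, div_div, div_mul_div_comm, mul_one]
    refine div_le_div_of_nonneg_left (by positivity) (by positivity) ?_
    norm_num
    linarith
  · intro b
    have hw : ∀ j, |weights (α / m ^ 2) b j| ≤ α / m ^ 2 := by
      intro j
      rw [weights]
      split_ifs
      · rw [abs_of_pos (by positivity)]
      · rw [abs_zero]; positivity
    refine bumpSum_mem_sobolevClass hK hℓ0.le hℓ hμ hmpos
      (fun j => (hw j).trans (hα4.trans hα2)) ?_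
    have : ∑ j, weights (α / m ^ 2) b j ^ 2 ≤ m * (α / m ^ 2) ^ 2 := by
      calc _ ≤ ∑ _ : Fin m, (α / m ^ 2) ^ 2 :=
            Finset.sum_le_sum fun j _ => by
              rw [← sq_abs]; gcongr; exact hw j
        _ = _ := by simp
    calc _ ≤ (m : ℝ) ^ 3 * K ^ 2 * (m * (α / m ^ 2) ^ 2) := by gcongr
      _ = (K * α) ^ 2 := by field_simp
      _ ≤ ℓ ^ 2 := by gcongr
  · have h5 : (n : ℝ) ≤ m ^ 5 := by rw [← hT5]; gcongr
    have h6 : α ^ 2 ≤ (σ / 2) ^ 2 := by gcongr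
    have h7 := Real.log_two_gt_d9
    rw [div_le_iff₀ (by positivity)]
    calc (α / m ^ 2) ^ 2 * (2 * n) ≤ (α / m ^ 2) ^ 2 * (2 * m ^ 5) := by gcongr
      _ = 2 * α ^ 2 * m := by field_simp
      _ ≤ 2 * (σ / 2) ^ 2 * m := by gcongr
      _ = 1 / 2 * (m * σ ^ 2) := by ring
      _ ≤ _ := by gcongr; linarith

end

/-! ### One bump: the supremum loss -/

section

variable {m : ℕ}

/-- The values at the design points of the single bump of height `a` in the `j`-th bin. -/
noncomputable def bumpValues {n : ℕ} (x : Fin n → ℝ) (a : ℝ) (j : Fin m) (i : Fin n) : ℝ :=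
  bumpSum bump (Pi.single j a) (x i)

theorem sum_bumpValues_mul_eq_zero {n : ℕ} {v : NNReal} (x : Fin n → ℝ) (a : ℝ) {j k : Fin m}
    (hjk : j ≠ k) : ∑ i, bumpValues x a j i * bumpValues x a k i / v = 0 := by
  refine Finset.sum_eq_zero fun i _ => ?_
  simp only [bumpValues, bumpSum_single]
  by_cases hj : x i ∈ bin j
  · rw [bump_zero_of_half_le (m * x i - k - 1 / 2) (not_lt.1 fun hk => hjk (bin_disjoint hj hk))]
    simp
  · rw [bump_zero_of_half_le (m * x i - j - 1 / 2) (not_lt.1 hj)]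
    simp

/-- The likelihood ratio of the mixture of all single-bump hypotheses in the bins of `J`. -/
noncomputable def mixtureRatio {n : ℕ} (v : NNReal) (x : Fin n → ℝ) (a : ℝ) (J : Finset (Fin m))
    (ε : Fin n → ℝ) : ℝ≥0∞ :=
  (J.card : ℝ≥0∞)⁻¹ * ∑ j ∈ J, likelihoodRatio v (bumpValues x a j) ε

theorem measurable_mixtureRatio {n : ℕ} (v : NNReal) (x : Fin n → ℝ) (a : ℝ)
    (J : Finset (Fin m)) : Measurable (mixtureRatio v x a J) :=
  (Finset.measurable_sum _ fun _ _ => measurable_likelihoodRatio _ _).const_mul _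

theorem lintegral_mixtureRatio {n : ℕ} {v : NNReal} (hv : v ≠ 0) (x : Fin n → ℝ) (a : ℝ)
    {J : Finset (Fin m)} (hJ : J.Nonempty) :
    ∫⁻ ε, mixtureRatio v x a J ε ∂gaussianNoise v n = 1 := by
  unfold mixtureRatio
  rw [lintegral_const_mul _ (Finset.measurable_fun_sum _ fun _ _ => measurable_likelihoodRatio _ _),
    lintegral_finsetSum _ fun _ _ => measurable_likelihoodRatio _ _]
  simp only [lintegral_likelihoodRatio hv, Finset.sum_const, nsmul_eq_mul, mul_one]
  exact ENNReal.inv_mul_cancel (by simpa using hJ.ne_empty) (by simp)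

/-- The second moment of the mixture ratio: the off-diagonal terms contribute at most `1` because
different bumps see different design points, the diagonal terms at most `1` by the hypothesis. -/
theorem lintegral_mixtureRatio_sq_le {n : ℕ} {v : NNReal} (hv : v ≠ 0) (x : Fin n → ℝ) (a : ℝ)
    {J : Finset (Fin m)} (hJ : J.Nonempty)
    (h : ∀ j ∈ J, Real.exp (∑ i, bumpValues x a j i * bumpValues x a j i / v) ≤ J.card) :
    ∫⁻ ε, mixtureRatio v x a J ε * mixtureRatio v x a J ε ∂gaussianNoise v n ≤ 2 := by
  have hjk : ∀ j k : Fin m, Measurable fun ε =>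
      likelihoodRatio v (bumpValues x a j) ε * likelihoodRatio v (bumpValues x a k) ε :=
    fun j k => (measurable_likelihoodRatio v _).mul (measurable_likelihoodRatio v _)
  have hN : (J.card : ℝ≥0∞) ≠ 0 := by simpa using hJ.ne_empty
  have h1 : ∀ ε, mixtureRatio v x a J ε * mixtureRatio v x a J ε
      = ((J.card : ℝ≥0∞)⁻¹ * (J.card : ℝ≥0∞)⁻¹) * ∑ j ∈ J, ∑ k ∈ J,
        likelihoodRatio v (bumpValues x a j) ε * likelihoodRatio v (bumpValues x a k) ε := by
    intro ε
    rw [← Finset.sum_mul_sum]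
    unfold mixtureRatio
    ring
  have h2 : ∀ j ∈ J, ∑ k ∈ J, ENNReal.ofReal (Real.exp
      (∑ i, bumpValues x a j i * bumpValues x a k i / v)) ≤ 2 * J.card := by
    intro j hj
    calc _ ≤ ∑ k ∈ J, (1 + if j = k then (J.card : ℝ≥0∞) else 0) := by
          refine Finset.sum_le_sum fun k hk => ?_
          rcases eq_or_ne j k with rfl | hjk
          · rw [if_pos rfl, ← ENNReal.ofReal_natCast]
            exact (ENNReal.ofReal_le_ofReal (h j hj)).trans le_add_self
          · rw [sum_bumpValues_mul_eq_zero x a hjk]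
            simp
      _ = 2 * J.card := by
          rw [Finset.sum_add_distrib, Finset.sum_ite_eq, if_pos hj]
          simp [two_mul]
  simp_rw [h1]
  have h3 : Measurable fun ε => ∑ j ∈ J, ∑ k ∈ J,
        likelihoodRatio v (bumpValues x a j) ε * likelihoodRatio v (bumpValues x a k) ε :=
    Finset.measurable_fun_sum _ fun j _ => Finset.measurable_fun_sum _ fun k _ => hjk j k
  rw [lintegral_const_mul _ h3, lintegral_finsetSum _ fun j _ =>
    Finset.measurable_fun_sum _ fun k _ => hjk j k]
  have h4 : ∀ j ∈ J, ∫⁻ ε, ∑ k ∈ J, likelihoodRatio v (bumpValues x a j) ε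
      * likelihoodRatio v (bumpValues x a k) ε ∂gaussianNoise v n ≤ 2 * J.card := by
    intro j hj
    rw [lintegral_finsetSum _ fun k _ => hjk j k]
    simp_rw [lintegral_likelihoodRatio_mul hv]
    exact h2 j hj
  calc _ ≤ (J.card : ℝ≥0∞)⁻¹ * (J.card : ℝ≥0∞)⁻¹ * ∑ _ ∈ J, 2 * (J.card : ℝ≥0∞) := by
        gcongr with j hj
        exact h4 j hj
    _ = 2 * ((J.card : ℝ≥0∞)⁻¹ * J.card) * ((J.card : ℝ≥0∞)⁻¹ * J.card) := by
        rw [Finset.sum_const, nsmul_eq_mul]; ring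
    _ = 2 := by rw [ENNReal.inv_mul_cancel hN (by simp)]; simp

/-- The point at which the `j`-th bump attains its height. -/
noncomputable def binCenter (j : Fin m) : ℝ := (j + 1 / 2) / m

theorem binCenter_mem_plateau (j : Fin m) : binCenter j ∈ plateau j := by
  have hm : (m : ℝ) ≠ 0 := by exact_mod_cast j.pos.ne'
  rw [mem_plateau_iff, binCenter, mul_div_cancel₀ _ hm]
  norm_num

theorem enorm_binCenter_le_lossSup (j : Fin m) (f g : ℝ → ℝ) :
    ‖f (binCenter j) - g (binCenter j)‖ₑ ^ 2 ≤ lossSup f g := by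
  unfold lossSup
  gcongr
  exact le_iSup₂ (f := fun t _ => ‖f t - g t‖ₑ) (binCenter j)
    (bin_subset_Icc j (plateau_subset_bin j (binCenter_mem_plateau j)))

/-- Testing the zero function against the mixture of the single bumps in the bins of `J`, by the
values of the estimator at the centres of the bins. -/
theorem le_minimaxRisk_lossSup_of_bumps {F : Set (ℝ → ℝ)} {σ : ℝ} (hσ : 0 < σ) {n q : ℕ}
    (hn : 1 ≤ n) (x : Fin n → ℝ) (m₂ : ℝ≥0∞) (hm : 0 < m) {a : ℝ}
    (hF0 : (fun _ => 0) ∈ F) (hF : ∀ j : Fin m, bumpSum bump (Pi.single j a) ∈ F)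
    (ha : Real.exp (a ^ 2 * (2 * n) / (m * σ ^ 2)) ≤ m / 2) :
    ENNReal.ofReal (a ^ 2 / 16) ≤ minimaxRisk lossSup F σ x q m₂ := by
  refine le_iInf₂ fun fhat hf => ?_
  set S := ⨆ (f ∈ F) (ν : Measure ℝ) (_ : IsNoiseLaw σ ν), risk lossSup x q m₂ ν f fhat with hS
  set v := (σ ^ 2).toNNReal
  have hv : v ≠ 0 := by simpa [v] using hσ.ne'
  have hvc : (v : ℝ) = σ ^ 2 := Real.coe_toNNReal _ (sq_nonneg σ)
  set J := goodBins m x with hJdef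
  have hc : (m : ℝ) ≤ 2 * J.card := by exact_mod_cast le_two_mul_card_goodBins hn m x
  have hJ : J.Nonempty := by
    rw [← Finset.card_pos]
    have : m ≤ 2 * J.card := le_two_mul_card_goodBins hn m x
    omega
  have hN : (J.card : ℝ≥0∞) ≠ 0 := by simpa using hJ.ne_empty
  have hsq : ∀ j ∈ J, Real.exp (∑ i, bumpValues x a j i * bumpValues x a j i / v) ≤ J.card := by
    intro j hj
    refine le_trans (Real.exp_le_exp.2 ?_) (ha.trans (by linarith))
    refine (sum_bumpSum_single_le x j a).trans ?_
    rw [hvc]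
    exact binCount_div_le hj (by positivity)
  have hfj : ∀ j : Fin m, Measurable fun y => fhat y (binCenter j) := fun j =>
    hf.comp measurable_prodMk_right
  set G₀ : (Fin n → ℝ) → ℝ≥0∞ := fun y => ⨆ j ∈ J, ‖0 - fhat y (binCenter j)‖ₑ ^ 2 with hG₀
  set G : Fin m → (Fin n → ℝ) → ℝ≥0∞ := fun j y => ‖a - fhat y (binCenter j)‖ₑ ^ 2 with hG
  have hG₀m : Measurable G₀ := .iSup fun j => .iSup fun _ =>
    (measurable_const.sub (hfj j)).enorm.pow_const 2
  have hGm : ∀ j, Measurable (G j) := fun j => (measurable_const.sub (hfj j)).enorm.pow_const 2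
  have hpoint : ∀ ε, ENNReal.ofReal (a ^ 2 / 4) * min 1 (mixtureRatio v x a J ε)
      ≤ G₀ ε + (J.card : ℝ≥0∞)⁻¹ * ∑ j ∈ J, likelihoodRatio v (bumpValues x a j) ε * G j ε := by
    intro ε
    by_cases h : ENNReal.ofReal (a ^ 2 / 4) ≤ G₀ ε
    · calc _ ≤ ENNReal.ofReal (a ^ 2 / 4) * 1 := by gcongr; exact min_le_left _ _
        _ ≤ _ := by rw [mul_one]; exact h.trans le_self_add
    · have hj : ∀ j ∈ J, ENNReal.ofReal (a ^ 2 / 4) ≤ G j ε := by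
        intro j hj
        have h1 := half_sq_le_enorm a (fhat ε (binCenter j))
        rw [show a ^ 2 / 2 = a ^ 2 / 4 + a ^ 2 / 4 by ring,
          ENNReal.ofReal_add (by positivity) (by positivity)] at h1
        have h2 : ‖0 - fhat ε (binCenter j)‖ₑ ^ 2 ≤ ENNReal.ofReal (a ^ 2 / 4) :=
          (le_iSup₂ (f := fun j (_ : j ∈ J) => ‖0 - fhat ε (binCenter j)‖ₑ ^ 2) j hj).trans
            (not_le.1 h).le
        exact (ENNReal.add_le_add_iff_right ENNReal.ofReal_ne_top).1
          (h1.trans (add_le_add_right h2 _))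
      calc _ ≤ ENNReal.ofReal (a ^ 2 / 4) * mixtureRatio v x a J ε := by
            gcongr; exact min_le_right _ _
        _ = (J.card : ℝ≥0∞)⁻¹ * ∑ j ∈ J, likelihoodRatio v (bumpValues x a j) ε
              * ENNReal.ofReal (a ^ 2 / 4) := by
            rw [mixtureRatio, ← Finset.sum_mul]; ring
        _ ≤ (J.card : ℝ≥0∞)⁻¹ * ∑ j ∈ J, likelihoodRatio v (bumpValues x a j) ε * G j ε := by
            gcongr with j hj'
            exact hj j hj'
        _ ≤ _ := le_add_self
  have hS₀ : ∫⁻ ε, G₀ ε ∂gaussianNoise v n ≤ S := by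
    refine le_trans (lintegral_mono fun ε => ?_) (le_iSup_risk hσ x q m₂ fhat hF0)
    have : (fun _ : Fin n => (0 : ℝ)) + ε = ε := zero_add ε
    simp only [this]
    exact iSup₂_le fun j _ => enorm_binCenter_le_lossSup j (fun _ => 0) (fhat ε)
  have hSj : ∀ j, ∫⁻ ε, likelihoodRatio v (bumpValues x a j) ε * G j ε ∂gaussianNoise v n ≤ S := by
    intro j
    rw [← lintegral_add_gaussianNoise hv _ (hGm j)]
    refine le_trans (lintegral_mono fun ε => ?_) (le_iSup_risk hσ x q m₂ fhat (hF j))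
    have := enorm_binCenter_le_lossSup j (bumpSum bump (Pi.single j a))
      (fhat (bumpValues x a j + ε))
    rwa [bumpSum_bump_of_mem_plateau (binCenter_mem_plateau j), Pi.single_eq_same] at this
  have hLm := measurable_mixtureRatio v x a J
  have hsum : ENNReal.ofReal (a ^ 2 / 4) * (1 / 2) ≤ S + S := by
    calc _ ≤ ENNReal.ofReal (a ^ 2 / 4)
          * ∫⁻ ε, min 1 (mixtureRatio v x a J ε) ∂gaussianNoise v n := by
          gcongr
          exact half_le_lintegral_min_one _ hLm (lintegral_mixtureRatio hv x a hJ)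
            (lintegral_mixtureRatio_sq_le hv x a hJ hsq)
      _ = ∫⁻ ε, ENNReal.ofReal (a ^ 2 / 4) * min 1 (mixtureRatio v x a J ε)
          ∂gaussianNoise v n := (lintegral_const_mul _ (measurable_const.min hLm)).symm
      _ ≤ _ := lintegral_mono hpoint
      _ = ∫⁻ ε, G₀ ε ∂gaussianNoise v n + (J.card : ℝ≥0∞)⁻¹ * ∑ j ∈ J,
          ∫⁻ ε, likelihoodRatio v (bumpValues x a j) ε * G j ε ∂gaussianNoise v n := by
          have hLG : ∀ j ∈ J, Measurable fun ε => likelihoodRatio v (bumpValues x a j) ε * G j ε :=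
            fun j _ => (measurable_likelihoodRatio _ _).mul (hGm j)
          rw [lintegral_add_left hG₀m, lintegral_const_mul _ (Finset.measurable_fun_sum _ hLG),
            lintegral_finsetSum _ hLG]
      _ ≤ S + (J.card : ℝ≥0∞)⁻¹ * ∑ _ ∈ J, S := by
          gcongr with j _
          exact hSj j
      _ = S + S := by
          rw [Finset.sum_const, nsmul_eq_mul, ← mul_assoc, ENNReal.inv_mul_cancel hN (by simp),
            one_mul]
  have h2 : ENNReal.ofReal (a ^ 2 / 4) * (1 / 2) = 2 * ENNReal.ofReal (a ^ 2 / 16) := by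
    have hhalf : (1 / 2 : ℝ≥0∞) = ENNReal.ofReal (1 / 2) := by
      rw [ENNReal.ofReal_div_of_pos (by norm_num)]; simp
    rw [hhalf, ← ENNReal.ofReal_mul (by positivity), ← ENNReal.ofReal_ofNat 2,
      ← ENNReal.ofReal_mul (by positivity)]
    congr 1
    ring
  rw [h2, ← two_mul] at hsum
  exact (ENNReal.mul_le_mul_iff_right (by simp) (by simp)).1 hsum

theorem log_le_sqrt {y : ℝ} (hy : 256 ≤ y) : Real.log y ≤ √y := by
  have hy0 : 0 < y := by linarith
  have h1 : Real.log y = 4 * Real.log √√y := by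
    rw [Real.log_sqrt (Real.sqrt_nonneg _), Real.log_sqrt hy0.le]; ring
  have h2 : (16 : ℝ) ≤ √y := Real.le_sqrt_of_sq_le (by linarith)
  have h3 : (4 : ℝ) ≤ √√y := Real.le_sqrt_of_sq_le (by linarith)
  have h4 : √√y * √√y = √y := Real.mul_self_sqrt (Real.sqrt_nonneg _)
  have h5 := Real.log_le_sub_one_of_pos (show 0 < √√y by linarith)
  nlinarith

/-- The rate for the supremum loss with `(n / log n) ^ (1/4)` bins, rounded up. The sample size
has to be large for the number of bins to exceed `2 n ^ (1/16)`, where `n ^ (1/16)` bounds the second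
moment of each single likelihood ratio. -/
theorem exists_le_minimaxRisk_lossSup_of_large {σ ℓ μ : ℝ} (hσ : 0 < σ) (hℓ0 : 0 < ℓ)
    (hμ0 : 0 < μ) {L m₁ : ℝ≥0∞} (hℓ : ENNReal.ofReal ℓ ≤ L) (hμ : ENNReal.ofReal μ ≤ m₁) :
    ∃ c : ℝ, 0 < c ∧ ∀ n q : ℕ, 2 ^ 16 ≤ n → ∀ (x : Fin n → ℝ) (m₂ : ℝ≥0∞),
      ENNReal.ofReal (c * (Real.log n / n) ^ (3 / 4 : ℝ)) ≤
        minimaxRisk lossSup (sobolevClass L m₁) σ x q m₂ := by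
  obtain ⟨K, hK0, hK⟩ := exists_bound_deriv_deriv_bump
  set α := min (ℓ / K) (min μ (σ / 8)) with hα
  have hα0 : 0 < α := by positivity
  have hα1 : K * α ≤ ℓ := by
    rw [mul_comm]; exact (le_div_iff₀ hK0).1 (min_le_left _ _)
  have hα2 : α ≤ μ := (min_le_right _ _).trans (min_le_left _ _)
  have hα3 : α ≤ σ / 8 := (min_le_right _ _).trans (min_le_right _ _)
  refine ⟨α ^ 2 / 128, by positivity, fun n q hn x m₂ => ?_⟩
  have hnbig : (2 : ℝ) ^ 16 ≤ n := by exact_mod_cast hn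
  have hn0 : (0 : ℝ) < n := by linarith [show (0 : ℝ) < 2 ^ 16 by norm_num]
  have hn1 : (1 : ℝ) < n := by linarith [show (1 : ℝ) < 2 ^ 16 by norm_num]
  have hlog0 : 0 < Real.log n := Real.log_pos hn1
  have hlogs : Real.log n ≤ √n := log_le_sqrt (by linarith [show (256 : ℝ) ≤ 2 ^ 16 by norm_num])
  have hs0 : 0 < √(n : ℝ) := Real.sqrt_pos.2 hn0
  have hratio : √(n : ℝ) ≤ n / Real.log n := by
    rw [le_div_iff₀ hlog0]
    calc √(n : ℝ) * Real.log n ≤ √n * √n := by gcongr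
      _ = n := Real.mul_self_sqrt hn0.le
  -- `U = n ^ (1/16)` satisfies `2 ≤ U`, and the number of bins is at least `U ^ 2`.
  set U := (n : ℝ) ^ (1 / 16 : ℝ) with hU
  have hU0 : 0 < U := Real.rpow_pos_of_pos hn0 _
  have hU16 : U ^ 16 = n := by
    rw [hU, ← Real.rpow_natCast, ← Real.rpow_mul hn0.le]; simp
  have hU2 : 2 ≤ U :=
    le_of_pow_le_pow_left₀ (n := 16) (by norm_num) hU0.le (by rw [hU16]; exact hnbig)
  have hUs : √(n : ℝ) = (U ^ 2) ^ 4 := by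
    rw [← hU16, show U ^ 16 = (U ^ 8) ^ 2 by ring, Real.sqrt_sq (by positivity)]
    ring
  set T := (n / Real.log n) ^ (1 / 4 : ℝ) with hT
  have hT0 : 0 < T := by positivity
  have hT4 : T ^ 4 = n / Real.log n := by
    rw [hT, ← Real.rpow_natCast, ← Real.rpow_mul (by positivity)]; simp
  have hTU : U ^ 2 ≤ T :=
    le_of_pow_le_pow_left₀ (n := 4) (by norm_num) hT0.le (by rw [hT4, ← hUs]; exact hratio)
  have hT1 : 1 ≤ T := by nlinarith
  have hT3 : (Real.log n / n) ^ (3 / 4 : ℝ) = 1 / T ^ 3 := by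
    rw [hT, ← Real.rpow_natCast, ← Real.rpow_mul (by positivity), one_div,
      ← Real.inv_rpow (by positivity), inv_div]
    norm_num
  set m := ⌈T⌉₊ with hm
  have hmT : T ≤ m := Nat.le_ceil T
  have hm0 : (1 : ℝ) ≤ m := hT1.trans hmT
  have hm2 : (m : ℝ) ≤ 2 * T := by linarith [Nat.ceil_lt_add_one hT0.le]
  have hmpos : 0 < m := by exact_mod_cast (zero_lt_one.trans_le hm0)
  set a := α / √((m : ℝ) ^ 3) with ha
  have ha0 : 0 < a := by positivity
  have ha2 : a ^ 2 = α ^ 2 / m ^ 3 := by rw [ha, div_pow, Real.sq_sqrt (by positivity)]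
  have haα : a ≤ α := div_le_self hα0.le (Real.one_le_sqrt.2 (one_le_pow₀ hm0))
  refine le_trans (ENNReal.ofReal_le_ofReal ?_)
    (le_minimaxRisk_lossSup_of_bumps (a := a) hσ (by omega) x m₂ hmpos ?_ ?_ ?_)
  · have h3 : (m : ℝ) ^ 3 ≤ 8 * T ^ 3 := by
      calc (m : ℝ) ^ 3 ≤ (2 * T) ^ 3 := by gcongr
        _ = _ := by ring
    rw [hT3, ha2, div_div, div_mul_div_comm, mul_one]
    refine div_le_div_of_nonneg_left (by positivity) (by positivity) ?_
    linarith
  · exact const_mem_sobolevClass (by simpa using hμ0.le) hμ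
  · intro j
    refine bumpSum_mem_sobolevClass hK hℓ0.le hℓ hμ hmpos (fun k => ?_) ?_
    · rcases eq_or_ne k j with rfl | h
      · rw [Pi.single_eq_same, abs_of_pos ha0]
        exact haα.trans hα2
      · rw [Pi.single_eq_of_ne h, abs_zero]
        exact hμ0.le
    · have : ∑ k, (Pi.single j a : Fin m → ℝ) k ^ 2 = a ^ 2 := by
        rw [Finset.sum_eq_single j (fun k _ hk => by simp [Pi.single_eq_of_ne hk]) (by simp)]
        simp
      rw [this, ha2]
      calc (m : ℝ) ^ 3 * K ^ 2 * (α ^ 2 / m ^ 3) = (K * α) ^ 2 := by field_simp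
        _ ≤ ℓ ^ 2 := by gcongr
  · have hm4 : (n : ℝ) ≤ m ^ 4 * Real.log n := by
      rw [← div_le_iff₀ hlog0, ← hT4]
      gcongr
    have hα4 : α ^ 2 ≤ (σ / 8) ^ 2 := by gcongr
    have hexp : a ^ 2 * (2 * n) / (m * σ ^ 2) ≤ Real.log n * (1 / 16) := by
      rw [div_le_iff₀ (by positivity), ha2]
      calc α ^ 2 / m ^ 3 * (2 * n) ≤ (σ / 8) ^ 2 / m ^ 3 * (2 * (m ^ 4 * Real.log n)) := by gcongr
        _ ≤ _ := by
          rw [div_mul_eq_mul_div, div_le_iff₀ (by positivity)]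
          have : 0 ≤ σ ^ 2 * m ^ 4 * Real.log n := by positivity
          nlinarith
    calc _ ≤ Real.exp (Real.log n * (1 / 16)) := Real.exp_le_exp.2 hexp
      _ = U := by rw [hU, Real.rpow_def_of_pos hn0]
      _ ≤ m / 2 := by nlinarith

theorem exists_le_minimaxRisk_lossSup {σ ℓ μ : ℝ} (hσ : 0 < σ) (hℓ0 : 0 < ℓ)
    (hμ0 : 0 < μ) {L m₁ : ℝ≥0∞} (hℓ : ENNReal.ofReal ℓ ≤ L) (hμ : ENNReal.ofReal μ ≤ m₁) :
    ∃ c : ℝ, 0 < c ∧ ∀ n q : ℕ, 1 ≤ n → ∀ (x : Fin n → ℝ) (m₂ : ℝ≥0∞),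
      ENNReal.ofReal (c * (Real.log n / n) ^ (3 / 4 : ℝ)) ≤
        minimaxRisk lossSup (sobolevClass L m₁) σ x q m₂ := by
  obtain ⟨c₁, hc₁, h₁⟩ := exists_le_minimaxRisk_lossSup_of_large hσ hℓ0 hμ0 hℓ hμ
  obtain ⟨c₂, hc₂, h₂⟩ := exists_le_minimaxRisk_lossTwo hσ hℓ0 hμ0 hℓ hμ
  refine ⟨min c₁ (c₂ / 2 ^ 16), by positivity, fun n q hn x m₂ => ?_⟩
  have hn1 : (1 : ℝ) ≤ n := by exact_mod_cast hn
  have hlog : 0 ≤ Real.log n / n := div_nonneg (Real.log_nonneg hn1) (by positivity)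
  rcases le_total (2 ^ 16) n with hbig | hsmall
  · refine le_trans (ENNReal.ofReal_le_ofReal ?_) (h₁ n q hbig x m₂)
    gcongr
    exact min_le_left _ _
  -- Boundedly many sample sizes remain, for which the rate of the integrated loss is enough.
  · refine le_trans (ENNReal.ofReal_le_ofReal ?_)
      ((h₂ n q hn x m₂).trans (minimaxRisk_lossTwo_le_lossSup _ σ x q m₂))
    have hlog1 : (Real.log n / n) ^ (3 / 4 : ℝ) ≤ 1 := by
      refine Real.rpow_le_one hlog ?_ (by norm_num)
      rw [div_le_one (by positivity)]
      linarith [Real.log_le_sub_one_of_pos (show (0 : ℝ) < n by positivity)]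
    have hpow : (n : ℝ) ^ (4 / 5 : ℝ) ≤ 2 ^ 16 := by
      calc (n : ℝ) ^ (4 / 5 : ℝ) ≤ (n : ℝ) ^ (1 : ℝ) :=
            Real.rpow_le_rpow_of_exponent_le hn1 (by norm_num)
        _ = n := Real.rpow_one _
        _ ≤ 2 ^ 16 := by exact_mod_cast hsmall
    calc min c₁ (c₂ / 2 ^ 16) * (Real.log n / n) ^ (3 / 4 : ℝ) ≤ (c₂ / 2 ^ 16) * 1 := by
          gcongr
          exact min_le_right _ _
      _ = c₂ * (1 / 2 ^ 16) := by ring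
      _ ≤ _ := by gcongr

theorem exists_pos_ofReal_le {b : ℝ≥0∞} (hb : 0 < b) : ∃ r : ℝ, 0 < r ∧ ENNReal.ofReal r ≤ b := by
  obtain ⟨r, hr0, hr⟩ := ENNReal.lt_iff_exists_nnreal_btwn.1 hb
  exact ⟨r, by exact_mod_cast hr0, by simpa using hr.le⟩

end

end RobustRegression

theorem theorem2 (σ : ℝ) (hσ : 0 < σ) (L m₁ : ℝ≥0∞) (hL : 0 < L) (hm₁ : 0 < m₁) :
    ∃ c : ℝ, 0 < c ∧
      ∀ (n q : ℕ), 1 ≤ n → q ≤ n →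
        ∀ x : Fin n → ℝ, (∀ i, x i ∈ Icc (0 : ℝ) 1) →
          ∀ m₂ : ℝ≥0∞,
            ENNReal.ofReal (c * (((q : ℝ) / n) ^ 3 + 1 / (n : ℝ) ^ (4 / 5 : ℝ))) ≤
                RobustRegression.minimaxRisk RobustRegression.lossTwo
                  (RobustRegression.sobolevClass L m₁) σ x q m₂ ∧
            ENNReal.ofReal (c * (((q : ℝ) / n) ^ 2 + (Real.log n / n) ^ (3 / 4 : ℝ))) ≤
                RobustRegression.minimaxRisk RobustRegression.lossSup
                  (RobustRegression.sobolevClass L m₁) σ x q m₂ := by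
  obtain ⟨ℓ, hℓ0, hℓ⟩ := RobustRegression.exists_pos_ofReal_le hL
  obtain ⟨μ, hμ0, hμ⟩ := RobustRegression.exists_pos_ofReal_le hm₁
  obtain ⟨c₁, hc₁, h₁⟩ :=
    RobustRegression.exists_le_minimaxRisk_contamination (L := L) hσ hμ0 hμ
  obtain ⟨c₂, hc₂, h₂⟩ := RobustRegression.exists_le_minimaxRisk_lossTwo hσ hℓ0 hμ0 hℓ hμ
  obtain ⟨c₃, hc₃, h₃⟩ := RobustRegression.exists_le_minimaxRisk_lossSup hσ hℓ0 hμ0 hℓ hμ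
  -- Two lower bounds give half of their sum.
  have hhalf : ∀ {r s c d d' : ℝ} {R : ℝ≥0∞}, 0 ≤ r → 0 ≤ s → c ≤ d / 2 → c ≤ d' / 2 →
      ENNReal.ofReal (d * r) ≤ R → ENNReal.ofReal (d' * s) ≤ R →
      ENNReal.ofReal (c * (r + s)) ≤ R := by
    intro r s c d d' R hr hs hd hd' hR hR'
    rcases le_total (d * r) (d' * s) with h | h
    · exact (ENNReal.ofReal_le_ofReal (by nlinarith)).trans hR'
    · exact (ENNReal.ofReal_le_ofReal (by nlinarith)).trans hR
  refine ⟨min c₁ (min c₂ c₃) / 2, by positivity, fun n q hn hq x _ m₂ => ?_⟩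
  have hn0 : (0 : ℝ) < n := by exact_mod_cast hn
  have hr0 : 0 ≤ (q : ℝ) / n := by positivity
  have hr1 : (q : ℝ) / n ≤ 1 := (div_le_one hn0).2 (by exact_mod_cast hq)
  have hlog : 0 ≤ Real.log n / n :=
    div_nonneg (Real.log_nonneg (by exact_mod_cast hn)) hn0.le
  have hc₁' : min c₁ (min c₂ c₃) / 2 ≤ c₁ / 2 := by gcongr; exact min_le_left _ _
  have hc₂' : min c₁ (min c₂ c₃) / 2 ≤ c₂ / 2 := by
    gcongr; exact (min_le_right _ _).trans (min_le_left _ _)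
  have hc₃' : min c₁ (min c₂ c₃) / 2 ≤ c₃ / 2 := by
    gcongr; exact (min_le_right _ _).trans (min_le_right _ _)
  have hcont : ∀ k : ℕ, k ≠ 0 → ENNReal.ofReal (c₁ * ((q : ℝ) / n) ^ k) ≤
      RobustRegression.minimaxRisk RobustRegression.lossTwo
        (RobustRegression.sobolevClass L m₁) σ x q m₂ := fun k hk =>
    (ENNReal.ofReal_le_ofReal (by gcongr; exact pow_le_of_le_one hr0 hr1 hk)).trans
      (h₁ n q hn hq x m₂)
  exact ⟨hhalf (by positivity) (by positivity) hc₁' hc₂' (hcont 3 (by norm_num)) (h₂ n q hn x m₂),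
    hhalf (by positivity) (by positivity) hc₁' hc₃' ((hcont 2 (by norm_num)).trans
      (RobustRegression.minimaxRisk_lossTwo_le_lossSup _ σ x q m₂)) (h₃ n q hn x m₂)⟩
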